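/- Let $\Bbbk$ be a commutative domain of prime characteristic $p$, and let $X$ be a commutative unital $\Bbbk$-algebra that is free of finite rank as a $\Bbbk$-module. Let $L$ be a restricted Lie algebra over $\Bbbk$ with $p$-mapping $a\mapsto a^{[p]}$, and let $U(L)=T(L)/\langle a\otimes b-b\otimes a-[a,b],\ a^{\otimes p}-a^{[p]}\rangle$ be its (restricted) universal enveloping algebra. Assume that $L$ is self-similar with alphabet $X$: it is endowed with a Lie algebra homomorphism $\psi:L\to (X\otimes L)\rtimes\operatorname{Der}X$, where derivations act on the first coordinate, which preserves the $p$-mapping; the $p$-mapping on the right is the one with $(x\otimes a)^{[p]}=x^p\otimes a^{[p]}$ and $\delta^{[p]}=\delta^p$. Assume that $L$ is faithful: no non-zero element of $L$ acts as zero in the action of $L$ on the tensor algebra $T(X)$ given by $a\cdot 1=0$ and $a\cdot(x_1\otimes\cdots\otimes x_n)=\sum x_1y_i\otimes(a_i\cdot x_2\otimes\cdots\otimes x_n)+(\delta x_1)\otimes x_2\otimes\cdots\otimes x_n$ if $\psi(a)=\sum y_i\otimes a_i+\delta$. Let $\lambda,\mu\in\mathbb R$ with $\lambda>|\mu|>1$.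 Assume that $L$ has two gradings by real numbers, with degree functions $\deg_\lambda$ and $\deg_\mu$, of dilations $\lambda$ and $\mu$ respectively. This means, for $\nu\in\{\lambda,\mu\}$: $X$ and $L$ are $\mathbb R$-graded as an algebra and as a Lie algebra, $\deg_\nu(a^{[p]})=p\deg_\nu(a)$ for homogeneous $a\in L$, and $\psi$ preserves degrees when $y\otimes b$ is given degree $\deg_\nu(y)+\nu\deg_\nu(b)$ and a derivation $\delta$ of $X$ has degree $d$ if it raises degrees by $d$. Assume that $L$ is generated, as a restricted Lie algebra, by finitely many elements that are homogeneous of positive degree with respect to $\deg_\lambda$. Extend $\deg_\mu$ to $U(L)$ by $\deg_\mu(a_1\cdots a_n)=\sum_i\deg_\mu(a_i)$ for homogeneous $a_i\in L$, and let $U_+$, $U_0$, $U_-$ be the spans of the homogeneous elements $u\in U(L)$ with $\deg_\mu(u)>0$, $=0$, $<0$ respectively. Then $U_+,U_0,U_-$ are subalgebras (with $1\in U_0$), \[U(L)=U_+\oplus U_0\oplus U_-,\] and $U_+$ and $U_-$ are locally nilpotent: each finite subset generates a nilpotent (non-unital) subalgebra. In particular, every homogeneous element $u\in U(L)$ with $\deg_\mu(u)\ne0$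 is nilpotent. -/

import Mathlib

open scoped TensorProduct

noncomputable section

namespace SelfSimilarLie

/-! ### Restricted Lie algebras -/

section Restricted

variable {L : Type*} [LieRing L]

/-- The Lie polynomial in Jacobson's formula `(x + y)^[p] = x^[p] + y^[p] + ∑ i, s_i(x, y)`, where
`i * s_i(x, y)` is the coefficient of `t ^ (i - 1)` in `ad(t x + y) ^ (p - 1) (x)`.
The coefficient is expanded as a sum over the words `w` in the letters `x` (`true`) and `y`
(`false`) of length `p - 1`; a word with `i - 1` letters `x` is weighted by the inverse of `i`
modulo `p`. (The only word with `i = p` contributes `ad(x) ^ (p - 1) (x) = 0`.) -/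
def jacobsonSum (p : ℕ) (x y : L) : L :=
  ∑ w : Fin (p - 1) → Bool,
    ((((Finset.univ.filter fun j => w j = true).card + 1 : ℕ) : ZMod p)⁻¹).val •
      (List.ofFn w).foldr (fun b z => ⁅if b then x else y, z⁆) x

variable (k : Type*) [CommRing k] [LieAlgebra k L]

/-- `f` is a `p`-mapping `x ↦ x^[p]` on the Lie algebra `L` over `k` (of characteristic `p`),
so that `(L, f)` is a restricted Lie algebra. -/
structure IsPMap (p : ℕ) (f : L → L) : Prop where
  smul : ∀ (c : k) (x : L), f (c • x) = c ^ p • f x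
  lie : ∀ x y : L, ⁅f x, y⁆ = (fun z => ⁅x, z⁆)^[p] y
  add : ∀ x y : L, f (x + y) = f x + f y + jacobsonSum p x y

end Restricted

/-! ### Restricted enveloping algebras -/

section Enveloping

variable (k : Type*) {L : Type*} [CommRing k] [LieRing L] [LieAlgebra k L]

/-- The relations `a b - b a = [a, b]` and `a ^ p = a^[p]` on the tensor algebra of `L`. -/
inductive EnvelopingRel (p : ℕ) (f : L → L) : TensorAlgebra k L → TensorAlgebra k L → Prop
  | lie (a b : L) : EnvelopingRel p f
      (TensorAlgebra.ι k a * TensorAlgebra.ι k b - TensorAlgebra.ι k b * TensorAlgebra.ι k a)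
      (TensorAlgebra.ι k ⁅a, b⁆)
  | pow (a : L) : EnvelopingRel p f (TensorAlgebra.ι k a ^ p) (TensorAlgebra.ι k (f a))

/-- The (restricted) universal enveloping algebra `U(L)` of the restricted Lie algebra `(L, f)`. -/
def Enveloping (p : ℕ) (f : L → L) : Type _ := RingQuot (EnvelopingRel k p f)

instance (p : ℕ) (f : L → L) : Ring (Enveloping k p f) :=
  inferInstanceAs (Ring (RingQuot (EnvelopingRel k p f)))

instance (p : ℕ) (f : L → L) : Algebra k (Enveloping k p f) :=
  inferInstanceAs (Algebra k (RingQuot (EnvelopingRel k p f)))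

/-- The canonical map `L → U(L)`. -/
def Enveloping.ι (p : ℕ) (f : L → L) : L →ₗ[k] Enveloping k p f :=
  (RingQuot.mkAlgHom k (EnvelopingRel k p f)).toLinearMap ∘ₗ TensorAlgebra.ι k

/-- The homogeneous elements of degree `d` of `U(L)`, for the grading induced by a grading `ℒ`
of `L`: the span of all products `a₁ ⋯ aₙ` of homogeneous elements of `L` whose degrees have
sum `d`. -/
def Enveloping.homogeneous (p : ℕ) (f : L → L) (ℒ : ℝ → Submodule k L) (d : ℝ) :
    Submodule k (Enveloping k p f) :=
  Submodule.span k {u | ∃ l : List (ℝ × L), (∀ q ∈ l, q.2 ∈ ℒ q.1) ∧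
    (l.map Prod.fst).sum = d ∧ u = (l.map fun q => Enveloping.ι k p f q.2).prod}

/-- The span of the homogeneous elements of `U(L)` whose degree has sign `s`: these are
`U₊`, `U₀`, `U₋` for `s = 1`, `0`, `-1`. -/
def Enveloping.signPart (p : ℕ) (f : L → L) (ℒ : ℝ → Submodule k L) (s : SignType) :
    Submodule k (Enveloping k p f) :=
  ⨆ (d : ℝ) (_ : SignType.sign d = s), Enveloping.homogeneous k p f ℒ d

/-- A subset of an associative algebra is locally nilpotent if each finite subset of it generates
a nilpotent (non-unital) subalgebra `B`, that is, `B ^ n = 0` for some `n`. -/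
def IsLocallyNilpotent {A : Type*} [Ring A] [Algebra k A] (V : Set A) : Prop :=
  ∀ F : Finset A, (F : Set A) ⊆ V → ∃ n : ℕ, ∀ l : List A, l.length = n →
    (∀ x ∈ l, x ∈ NonUnitalAlgebra.adjoin k (F : Set A)) → l.prod = 0

end Enveloping

/-! ### Wreath products and self-similar Lie algebras -/

section Wreath

variable (k X L : Type*) [CommRing k] [CommRing X] [Algebra k X] [LieRing L] [LieAlgebra k L]

/-- The derivations of `X` act on the Lie algebra `X ⊗ L` by deriving the first coordinate. -/
def derAction : Derivation k X X →ₗ⁅k⁆ LieDerivation k (X ⊗[k] L) (X ⊗[k] L) where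
  toFun δ :=
    { toLinearMap := LinearMap.rTensor L (δ : X →ₗ[k] X)
      leibniz' := fun v w => by
        induction v using TensorProduct.induction_on with
        | zero => simp
        | add v v' hv hv' => simp only [add_lie, map_add, lie_add, hv, hv']; abel
        | tmul x a =>
          induction w using TensorProduct.induction_on with
          | zero => simp
          | add w w' hw hw' => simp only [add_lie, map_add, lie_add, hw, hw']; abel
          | tmul y b =>
            simp only [LieAlgebra.ExtendScalars.bracket_tmul, LinearMap.rTensor_tmul,
              Derivation.coeFn_coe, Derivation.leibniz, smul_eq_mul, TensorProduct.add_tmul]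
            rw [← lie_skew a b, TensorProduct.tmul_neg]
            simp only [TensorProduct.tmul_neg]
            abel }
  map_add' δ ε := by
    ext v
    exact congrArg (fun g : X ⊗[k] L →ₗ[k] X ⊗[k] L => g v)
      (LinearMap.rTensor_add L (δ : X →ₗ[k] X) (ε : X →ₗ[k] X))
  map_smul' c δ := by
    ext v
    exact congrArg (fun g : X ⊗[k] L →ₗ[k] X ⊗[k] L => g v)
      (LinearMap.rTensor_smul L c (δ : X →ₗ[k] X))
  map_lie' := by
    intro δ ε
    ext v
    induction v using TensorProduct.induction_on with
    | zero => simp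
    | add v w hv hw => rw [map_add, map_add, hv, hw]
    | tmul x a =>
      simp only [LieDerivation.lie_apply, LieDerivation.mk_coe, LinearMap.rTensor_tmul,
        Derivation.coeFn_coe, Derivation.commutator_apply, TensorProduct.sub_tmul]

/-- The wreath product `L ≀ Der X = (X ⊗ L) ⋊ Der X`. -/
abbrev Wreath : Type _ :=
  LieAlgebra.SemiDirectSum (X ⊗[k] L) (Derivation k X X) (derAction k X L)

variable {k X L}

/-- `P` is the `p`-mapping of the wreath product `L ≀ Der X`, where `f` is the `p`-mapping of `L`:
it is given by `(x ⊗ a)^[p] = x ^ p ⊗ a^[p]` on `X ⊗ L` and by `δ^[p] = δ ∘ ⋯ ∘ δ` on `Der X`. -/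
structure IsWreathPMap (p : ℕ) (f : L → L) (P : Wreath k X L → Wreath k X L) : Prop where
  isPMap : IsPMap k p P
  tmul : ∀ (x : X) (a : L), P ⟨x ⊗ₜ[k] a, 0⟩ = ⟨(x ^ p) ⊗ₜ[k] f a, 0⟩
  der_left : ∀ δ : Derivation k X X, (P ⟨0, δ⟩).left = 0
  der_right : ∀ (δ : Derivation k X X) (x : X), (P ⟨0, δ⟩).right x = δ^[p] x

/-- The self-similarity structure `ψ` preserves the `p`-mapping. -/
def PreservesPMap (p : ℕ) (f : L → L) (ψ : L →ₗ⁅k⁆ Wreath k X L) : Prop :=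
  ∃ P : Wreath k X L → Wreath k X L, IsWreathPMap p f P ∧ ∀ a : L, ψ (f a) = P (ψ a)

/-- The natural action of `a : L` on the elementary tensor `x₁ ⊗ ⋯ ⊗ xₙ` of `T(X)`, given as the
list `[x₁, …, xₙ]`: it is `0` for `n = 0`, and otherwise
`∑ x₁ yᵢ ⊗ (aᵢ · x₂ ⊗ ⋯ ⊗ xₙ) + (δ x₁) ⊗ x₂ ⊗ ⋯ ⊗ xₙ` if `ψ a = ∑ yᵢ ⊗ aᵢ + δ`. -/
def naturalAction (ψ : L →ₗ⁅k⁆ Wreath k X L) : List X → L →ₗ[k] TensorAlgebra k X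
  | [] => 0
  | x :: w =>
    (LinearMap.mul' k (TensorAlgebra k X) ∘ₗ
        TensorProduct.map (TensorAlgebra.ι k ∘ₗ LinearMap.mulLeft k x) (naturalAction ψ w) ∘ₗ
        LieAlgebra.SemiDirectSum.projl (derAction k X L) ∘ₗ (ψ : L →ₗ[k] Wreath k X L)) +
      { toFun := fun a =>
          TensorAlgebra.ι k ((ψ a).right x) * (w.map (TensorAlgebra.ι k)).prod
        map_add' := fun a b => by simp [add_mul]
        map_smul' := fun c a => by simp }

/-- The self-similar Lie algebra `(L, ψ)` is faithful: only `0` acts as zero on `T(X)`. (The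
elementary tensors span `T(X)`.) -/
def IsFaithful (ψ : L →ₗ⁅k⁆ Wreath k X L) : Prop :=
  ∀ a : L, (∀ w : List X, naturalAction ψ w a = 0) → a = 0

/-- The elements of degree `d` of the wreath product, for gradings `𝒳` of `X` and `ℒ` of `L` and
the dilation `dil`: the `X ⊗ L` component is a sum of tensors `y ⊗ a` with
`deg y + dil * deg a = d`, and the `Der X` component is a derivation of degree `d`. -/
def wreathDegree (dil : ℝ) (𝒳 : ℝ → Submodule k X) (ℒ : ℝ → Submodule k L) (d : ℝ) :
    Set (Wreath k X L) :=
  {v | v.left ∈ Submodule.span k {t : X ⊗[k] L | ∃ (e f : ℝ) (y : X) (a : L),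
      y ∈ 𝒳 e ∧ a ∈ ℒ f ∧ e + dil * f = d ∧ t = y ⊗ₜ[k] a} ∧
    ∀ (e : ℝ) (x : X), x ∈ 𝒳 e → v.right x ∈ 𝒳 (d + e)}

/-- `𝒳` and `ℒ` are gradings of the alphabet `X` and of the restricted Lie algebra `(L, f)` by real
degrees, and they are compatible with the self-similarity structure `ψ` for the dilation `dil`. -/
structure IsSelfSimilarGrading (p : ℕ) (f : L → L) (ψ : L →ₗ⁅k⁆ Wreath k X L) (dil : ℝ)
    (𝒳 : ℝ → Submodule k X) (ℒ : ℝ → Submodule k L) : Prop where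
  alphabet_isInternal : DirectSum.IsInternal 𝒳
  alphabet_graded : SetLike.GradedMonoid 𝒳
  isInternal : DirectSum.IsInternal ℒ
  lie_mem : ∀ (d e : ℝ) (a b : L), a ∈ ℒ d → b ∈ ℒ e → ⁅a, b⁆ ∈ ℒ (d + e)
  pMap_mem : ∀ (d : ℝ) (a : L), a ∈ ℒ d → f a ∈ ℒ (p * d)
  compatible : ∀ (d : ℝ) (a : L), a ∈ ℒ d → ψ a ∈ wreathDegree dil 𝒳 ℒ d

end Wreath

/-- `S` generates the restricted Lie algebra `(L, f)`: the only Lie subalgebra that contains `S`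
and is closed under the `p`-mapping is `L` itself. -/
def GeneratesRestricted (k : Type*) {L : Type*} [CommRing k] [LieRing L] [LieAlgebra k L]
    (f : L → L) (S : Set L) : Prop :=
  ∀ M : LieSubalgebra k L, S ⊆ (M : Set L) → (∀ a ∈ M, f a ∈ M) → M = ⊤

end SelfSimilarLie

end

/-! The point is that deg_μ grows more slowly than deg_λ. Since `X` has finite rank, its degrees are
bounded, so applying `ψ` to a homogeneous element divides its λ-degree by λ and its μ-degree by μ,
up to bounded errors. Faithfulness makes `ψ` injective, so degrees can be read off from the image.
Iterating down to the finitely many generators of small λ-degree bounds |deg_μ| by a multiple of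
deg_λ to the power log|μ|/log λ < 1, hence by ε·deg_λ for all large degrees
(`exists_forall_le_boundedPart`).

This passes to `U(L)` as |deg_μ| ≤ C + ε·deg_λ for every ε > 0
(`exists_homogeneous_le_boundedPart`). Only finitely many spanning elements of `L` violate the
ε-bound, and straightening lets each of them occur fewer than `p` times in a word, at bounded total
cost.

A product of ℓ elements from a finite subset of U₊ has μ-degrees at least ηℓ and λ-degrees at most
mℓ, so μ-degrees at most C + εmℓ. With εm ≤ η/2 these ranges are disjoint for large ℓ. As deg_μ is a
genuine grading of `U(L)` (`exists_isSplitting_homogeneous`), the product vanishes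
(`exists_forall_prod_eq_zero`). U₋ is symmetric. -/

noncomputable section

namespace SelfSimilarLie

/-! ### Jacobson's formula in associative rings of characteristic `p` -/

section Jacobson

attribute [local instance] LieRing.ofAssociativeRing

variable {A : Type*} [Ring A]

open Polynomial in
theorem derivative_pow_eq_sum (q : A[X]) (n : ℕ) :
    derivative (q ^ n) = ∑ i ∈ Finset.range n, q ^ i * derivative q * q ^ (n - 1 - i) := by
  induction n with
  | zero => simp
  | succ n ih =>
    rw [pow_succ, derivative_mul, ih, Finset.sum_range_succ, Finset.sum_mul]
    congr 1
    · refine Finset.sum_congr rfl fun i hi => ?_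
      have hi := Finset.mem_range.mp hi
      rw [mul_assoc, ← pow_succ]
      congr 2
      omega
    · simp

theorem cast_neg_one_pow_mul_choose {p : ℕ} (hp : p.Prime) (h0 : (p : A) = 0) (i : ℕ)
    (hi : i < p) : (-1 : A) ^ i * ((p - 1).choose i : A) = 1 := by
  induction i with
  | zero => simp
  | succ i ih =>
    have h1 : (p - 1).choose i + (p - 1).choose (i + 1) = p.choose (i + 1) := by
      rw [← Nat.choose_succ_succ', Nat.sub_add_cancel hp.one_le]
    obtain ⟨c, hc⟩ := hp.dvd_choose_self (Nat.succ_ne_zero i) hi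
    have h2 : ((p - 1).choose i : A) + ((p - 1).choose (i + 1) : A) = 0 := by
      rw [← Nat.cast_add, h1, hc, Nat.cast_mul, h0, zero_mul]
    rw [pow_succ, eq_neg_of_add_eq_zero_right h2, mul_assoc, neg_one_mul, neg_neg, ih (by omega)]

/-- Here ad z is the difference of the commuting left and right multiplications by `z`; in the
binomial expansion the signs cancel against `(p - 1).choose i ≡ (-1) ^ i` modulo `p`. -/
theorem iterate_lie_eq_sum {p : ℕ} (hp : p.Prime) (h0 : (p : A) = 0) (z w : A) :
    (fun u => ⁅z, u⁆)^[p - 1] w = ∑ i ∈ Finset.range p, z ^ i * w * z ^ (p - 1 - i) := by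
  have hc : Commute (LinearMap.mulLeft ℤ z) (-LinearMap.mulRight ℤ z) :=
    (LinearMap.commute_mulLeft_right z z (R := ℤ)).neg_right
  have hfun : (fun u => ⁅z, u⁆) = ⇑(LinearMap.mulLeft ℤ z + -LinearMap.mulRight ℤ z) := by
    ext u
    simp [Ring.lie_def, sub_eq_add_neg]
  rw [hfun, ← Module.End.coe_pow, hc.add_pow, Nat.sub_add_cancel hp.one_le, LinearMap.sum_apply]
  refine Finset.sum_congr rfl fun i hi => ?_
  have hi := Finset.mem_range.mp hi
  have h1 := cast_neg_one_pow_mul_choose hp h0 (p - 1 - i) (by omega)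
  rw [Nat.choose_symm (by omega : i ≤ p - 1)] at h1
  have h2 : (-LinearMap.mulRight ℤ z) ^ (p - 1 - i) =
      (-1) ^ (p - 1 - i) * LinearMap.mulRight ℤ (z ^ (p - 1 - i)) := by
    rw [neg_pow, LinearMap.pow_mulRight]
  have h3 : ∀ (n : ℕ) (v : A), ((-1 : Module.End ℤ A) ^ n) v = (-1) ^ n * v := by
    intro n v
    rcases n.even_or_odd with h | h <;> simp [h.neg_one_pow]
  rw [h2, LinearMap.pow_mulLeft, Module.End.mul_apply, Module.End.mul_apply, Module.End.mul_apply,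
    Module.End.natCast_apply, h3, nsmul_eq_mul, LinearMap.mulRight_apply, LinearMap.mulLeft_apply,
    mul_assoc, ← mul_assoc _ _ (w * z ^ (p - 1 - i)), h1, one_mul, mul_assoc]

-- Each bracket prepends a letter to the word, and the letter `x` brings a factor `X`. As `X` is
-- central, its exponent counts the letters `x`.
open Polynomial in
theorem iterate_lie_C (x y c : A) (n : ℕ) :
    (fun u => ⁅C x * X + C y, u⁆)^[n] (C c) = ∑ w : Fin n → Bool,
      C ((List.ofFn w).foldr (fun b z => ⁅if b then x else y, z⁆) c) *
        X ^ (Finset.univ.filter fun j => w j = true).card := by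
  induction n with
  | zero => simp
  | succ n ih =>
    have hsplit : ∀ F : (Fin (n + 1) → Bool) → A[X],
        ∑ w, F w = ∑ w : Fin n → Bool, (F (Fin.cons true w) + F (Fin.cons false w)) := by
      intro F
      rw [← (Fin.consEquiv fun _ => Bool).sum_comp, Fintype.sum_prod_type, Finset.sum_comm]
      simp [Fin.consEquiv]
    rw [Function.iterate_succ_apply', ih, lie_sum, hsplit]
    refine Finset.sum_congr rfl fun w _ => ?_
    have hcard : ∀ b : Bool, (Finset.univ.filter fun j =>
        (Fin.cons b w : Fin (n + 1) → Bool) j = true).card =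
        (Finset.univ.filter fun j => w j = true).card + if b then 1 else 0 := by
      intro b
      rw [Fin.card_filter_univ_succ]
      cases b <;> simp
    simp only [List.ofFn_succ, Fin.cons_zero,
      Fin.cons_succ, List.foldr_cons, hcard, if_true, Bool.false_eq_true, if_false, add_zero]
    generalize (List.ofFn w).foldr (fun b z => ⁅if b then x else y, z⁆) c = d
    generalize (Finset.univ.filter fun j => w j = true).card = m
    simp only [Ring.lie_def, map_sub, map_mul, add_mul, mul_add, pow_succ]
    have h1 : ∀ a : A[X], a * X = X * a := fun a => (commute_X a).symm.eq
    have h2 : ∀ a : A[X], X ^ m * a = a * X ^ m := fun a => (commute_X_pow a m).eq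
    have e1 : C x * X * (C d * X ^ m) = C x * C d * (X ^ m * X) := by
      rw [mul_assoc, mul_assoc (C x), ← mul_assoc X, ← h1 (C d), mul_assoc, ← pow_succ', pow_succ]
    have e2 : C d * X ^ m * (C x * X) = C d * C x * (X ^ m * X) := by
      rw [mul_assoc, ← mul_assoc (X ^ m), h2, mul_assoc, mul_assoc]
    have e3 : C d * X ^ m * C y = C d * C y * X ^ m := by
      rw [mul_assoc, h2, mul_assoc]
    rw [e1, e2, e3, sub_mul, sub_mul, mul_assoc (C y)]
    abel

open Polynomial in
/-- Jacobson's formula for the `p`-th power of a sum in a ring of characteristic `p`. -/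
theorem add_pow_eq_jacobsonSum {p : ℕ} [hp : Fact p.Prime] (h0 : (p : A) = 0) (x y : A) :
    (x + y) ^ p = x ^ p + y ^ p + jacobsonSum p x y := by
  set z : A[X] := C x * X + C y with hz
  have h0' : (p : A[X]) = 0 := by
    rw [← C_eq_natCast, h0, C_0]
  have hdeg : z.natDegree ≤ 1 := natDegree_linear_le
  have hdegp : (z ^ p).natDegree < p + 1 :=
    Nat.lt_succ_of_le (natDegree_pow_le_of_le p hdeg |>.trans (by simp))
  -- Both sides equal `∑ z ^ i * x * z ^ (p - 1 - i)`. Comparing coefficients determines all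
  -- coefficients of `z ^ p` except the two extreme ones, which are `y ^ p` and `x ^ p`.
  have hder : derivative (z ^ p) = (fun u => ⁅z, u⁆)^[p - 1] (C x) := by
    rw [derivative_pow_eq_sum, iterate_lie_eq_sum hp.out h0']
    simp [hz]
  rw [iterate_lie_C] at hder
  let g : (Fin (p - 1) → Bool) → A := fun w =>
    (List.ofFn w).foldr (fun b z => ⁅if b then x else y, z⁆) x
  let N : (Fin (p - 1) → Bool) → ℕ := fun w => (Finset.univ.filter fun j => w j = true).card
  have hcoef : ∀ i, (z ^ p).coeff (i + 1) * (i + 1) =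
      ∑ w : Fin (p - 1) → Bool, if N w = i then g w else 0 := by
    intro i
    rw [← coeff_derivative, hder, finsetSum_coeff]
    refine Finset.sum_congr rfl fun w _ => ?_
    rw [coeff_C_mul, coeff_X_pow]
    simp only [g, N, mul_ite, mul_one, mul_zero, eq_comm (a := i)]
  -- Over a noncommutative ring, evaluation at a central point is multiplicative; the points 1 and 0
  -- are enough.
  let e (t : A) (ht : ∀ a : A, Commute a t) : A[X] →+* A := eval₂RingHom' (RingHom.id A) t ht
  have hone : (x + y) ^ p = ∑ i ∈ Finset.range (p + 1), (z ^ p).coeff i := by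
    have h1 := map_pow (e 1 Commute.one_right) z p
    have h2 : e 1 Commute.one_right z = x + y := by
      rw [hz, map_add, map_mul]; simp [e, eval₂RingHom']
    rw [h2] at h1
    rw [← h1]
    exact (eval₂_eq_sum_range' (RingHom.id A) hdegp 1).trans (by simp)
  have hzero : (z ^ p).coeff 0 = y ^ p := by
    have h1 := map_pow (e 0 Commute.zero_right) z p
    have h2 : e 0 Commute.zero_right z = y := by
      rw [hz, map_add, map_mul]; simp [e, eval₂RingHom']
    rw [h2] at h1
    rw [← h1]
    exact (coeff_zero_eq_eval_zero _)
  have htop : (z ^ p).coeff p = x ^ p := by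
    have := coeff_pow_of_natDegree_le (m := p) hdeg
    rw [mul_one] at this
    rw [this]
    simp [hz]
  have hlow : ∀ i, i + 1 < p → (z ^ p).coeff (i + 1) =
      ∑ w : Fin (p - 1) → Bool,
        if N w = i then ((((N w + 1 : ℕ) : ZMod p)⁻¹).val • g w) else 0 := by
    intro i hi
    have hinv : ((((i + 1 : ℕ) : ZMod p)⁻¹).val * (i + 1) : A) = 1 := by
      have hne : ((i + 1 : ℕ) : ZMod p) ≠ 0 := by
        rw [Ne, ZMod.natCast_eq_zero_iff]
        exact fun h => absurd (Nat.le_of_dvd (Nat.succ_pos i) h) (by omega)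
      have h1 : (((((i + 1 : ℕ) : ZMod p)⁻¹).val * (i + 1) : ℕ) : ZMod p) = (1 : ℕ) := by
        rw [Nat.cast_mul, ZMod.natCast_zmod_val, inv_mul_cancel₀ hne, Nat.cast_one]
      rw [ZMod.natCast_eq_natCast_iff] at h1
      have h2 := (Nat.modEq_iff_dvd.mp h1.symm)
      obtain ⟨c, hc⟩ := h2
      have h3 := congrArg (Int.cast : ℤ → A) hc
      push_cast at h3
      rw [h0, zero_mul, sub_eq_zero] at h3
      exact_mod_cast h3
    have h3 : (z ^ p).coeff (i + 1) =
        (((i + 1 : ℕ) : ZMod p)⁻¹).val • ((z ^ p).coeff (i + 1) * (i + 1)) := by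
      rw [nsmul_eq_mul]
      have hcm : ∀ a : A, a * ((i : A) + 1) = ((i : A) + 1) * a := fun a => by
        have := (Nat.cast_commute (i + 1) a).eq
        push_cast at this
        exact this.symm
      rw [hcm, ← mul_assoc, hinv, one_mul]
    rw [h3, hcoef, Finset.smul_sum]
    refine Finset.sum_congr rfl fun w _ => ?_
    split_ifs with h
    · rw [h]
    · simp
  have hjac : jacobsonSum p x y = ∑ i ∈ Finset.range (p - 1), (z ^ p).coeff (i + 1) := by
    rw [Finset.sum_congr rfl fun i hi => hlow i (by have := Finset.mem_range.mp hi; omega),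
      Finset.sum_comm]
    refine Finset.sum_congr rfl fun w _ => ?_
    rw [Finset.sum_ite_eq]
    split_ifs with h
    · rfl
    · have hle : N w ≤ p - 1 := (Finset.card_filter_le _ _).trans (by simp)
      rw [Finset.mem_range] at h
      have hN : N w + 1 = p := by have := hp.out.one_le; omega
      -- The word with all letters `x` has weight `(p : ZMod p)⁻¹ = 0⁻¹ = 0`.
      change (((N w + 1 : ℕ) : ZMod p)⁻¹).val • g w = 0
      rw [hN]
      simp
  rw [hone, Finset.sum_range_succ, htop, hjac]
  obtain ⟨q, hq⟩ : ∃ q, p = q + 1 := ⟨p - 1, by have := hp.out.one_le; omega⟩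
  have hsum : ∑ i ∈ Finset.range p, (z ^ p).coeff i =
      ∑ i ∈ Finset.range (p - 1), (z ^ p).coeff (i + 1) + (z ^ p).coeff 0 := by
    rw [← Finset.sum_range_succ', Nat.sub_add_cancel hp.out.one_le]
  rw [hsum, hzero]
  abel

end Jacobson

theorem map_jacobsonSum {L A : Type*} [LieRing L] [LieRing A] (g : L →+ A)
    (hg : ∀ a b, g ⁅a, b⁆ = ⁅g a, g b⁆) (p : ℕ) (x y : L) :
    g (jacobsonSum p x y) = jacobsonSum p (g x) (g y) := by
  have h : ∀ (l : List Bool) (c : L), g (l.foldr (fun b z => ⁅if b then x else y, z⁆) c) =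
      l.foldr (fun b z => ⁅if b then g x else g y, z⁆) (g c) := by
    intro l c
    induction l with
    | nil => rfl
    | cons b l ih => rw [List.foldr_cons, hg, ih, List.foldr_cons, apply_ite g]
  rw [jacobsonSum, map_sum]
  simp only [map_nsmul, h]
  rfl

theorem jacobsonSum_mem {L : Type*} [LieRing L] {M : Type*} [SetLike M L]
    [AddSubgroupClass M L] (V : M) (hV : ∀ a b, a ∈ V → b ∈ V → ⁅a, b⁆ ∈ V) (p : ℕ) {x y : L}
    (hx : x ∈ V) (hy : y ∈ V) : jacobsonSum p x y ∈ V := by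
  have h : ∀ l : List Bool, l.foldr (fun b z => ⁅if b then x else y, z⁆) x ∈ V := by
    intro l
    induction l with
    | nil => exact hx
    | cons b l ih =>
      refine hV _ _ ?_ ih
      split_ifs
      · exact hx
      · exact hy
  exact sum_mem fun w _ => nsmul_mem (h _) _

/-! ### Families of submodules indexed by real degrees -/

section GradedPart

variable {k M : Type*} [CommRing k] [AddCommGroup M] [Module k M]

/-- The sum of the components of a family of submodules with index in `T`. -/
def gradedPart (V : ℝ → Submodule k M) (T : Set ℝ) : Submodule k M :=
  ⨆ (d : ℝ) (_ : d ∈ T), V d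

variable {V : ℝ → Submodule k M}

theorem mem_gradedPart_of_mem {T : Set ℝ} {d : ℝ} (hd : d ∈ T) {v : M} (hv : v ∈ V d) :
    v ∈ gradedPart V T :=
  Submodule.mem_iSup_of_mem d (Submodule.mem_iSup_of_mem hd hv)

theorem gradedPart_le {T : Set ℝ} {W : Submodule k M} :
    gradedPart V T ≤ W ↔ ∀ d ∈ T, V d ≤ W :=
  iSup₂_le_iff

theorem gradedPart_mono {T T' : Set ℝ} (h : T ⊆ T') : gradedPart V T ≤ gradedPart V T' :=
  gradedPart_le.2 fun _ hd _ hv => mem_gradedPart_of_mem (h hd) hv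

theorem gradedPart_univ : gradedPart V Set.univ = ⨆ d, V d := by
  simp [gradedPart]

/-- `Θ` splits each element into its components of the family `V`. -/
def IsSplitting (V : ℝ → Submodule k M) (Θ : M →ₗ[k] ℝ →₀ M) : Prop :=
  ∀ d, ∀ v ∈ V d, Θ v = Finsupp.single d v

/-- Conversely, a splitting forces the family to be independent, so for `U(L)` and `X ⊗ L` it
suffices to construct one. -/
theorem exists_isSplitting (hV : DirectSum.IsInternal V) : ∃ Θ, IsSplitting V Θ := by
  classical
  have h : Function.Bijective (DirectSum.coeLinearMap V) := hV
  refine ⟨DirectSum.toModule k ℝ (ℝ →₀ M) (fun d => Finsupp.lsingle d ∘ₗ (V d).subtype) ∘ₗ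
    (LinearEquiv.ofBijective (DirectSum.coeLinearMap V) h).symm.toLinearMap, fun d v hv => ?_⟩
  have h1 : (LinearEquiv.ofBijective (DirectSum.coeLinearMap V) h).symm v =
      DirectSum.lof k ℝ (fun d => V d) d ⟨v, hv⟩ := by
    rw [LinearEquiv.symm_apply_eq, LinearEquiv.ofBijective_apply, DirectSum.coeLinearMap_lof]
  rw [LinearMap.comp_apply, LinearEquiv.coe_coe, h1, DirectSum.toModule_lof]
  rfl

namespace IsSplitting

variable {Θ : M →ₗ[k] ℝ →₀ M}

theorem apply_eq_zero (h : IsSplitting V Θ) {T : Set ℝ} {v : M} (hv : v ∈ gradedPart V T) {d : ℝ} (hd : d ∉ T) :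
    Θ v d = 0 := by
  have : gradedPart V T ≤ LinearMap.ker (Finsupp.lapply d ∘ₗ Θ) := by
    refine gradedPart_le.2 fun e he w hw => ?_
    rw [LinearMap.mem_ker, LinearMap.comp_apply, h e w hw, Finsupp.lapply_apply,
      Finsupp.single_eq_of_ne]
    rintro rfl
    exact hd he
  exact this hv

theorem sum_eq_and_mem (h : IsSplitting V Θ) (hV : ⨆ d, V d = ⊤) (v : M) :
    ((Θ v).sum fun _ w => w) = v ∧ ∀ d, Θ v d ∈ V d := by
  have hv : v ∈ ⨆ d, V d := hV ▸ Submodule.mem_top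
  refine Submodule.iSup_induction V
    (motive := fun v => ((Θ v).sum fun _ w => w) = v ∧ ∀ d, Θ v d ∈ V d) hv
    (fun e w hw => ?_) (by simp) fun v w hv hw => ?_
  · rw [h e w hw]
    refine ⟨Finsupp.sum_single_index rfl, fun d => ?_⟩
    rw [Finsupp.single_apply]
    split_ifs with hd
    · exact hd ▸ hw
    · exact zero_mem _
  · rw [map_add]
    refine ⟨?_, fun d => add_mem (hv.2 d) (hw.2 d)⟩
    rw [Finsupp.sum_add_index' (fun _ => rfl) fun _ _ _ => rfl, hv.1, hw.1]

theorem mem_gradedPart (h : IsSplitting V Θ) (hV : ⨆ d, V d = ⊤) {T : Set ℝ} {v : M} (hv : ∀ d ∉ T, Θ v d = 0) :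
    v ∈ gradedPart V T := by
  rw [← (h.sum_eq_and_mem hV v).1]
  refine sum_mem fun d hd => ?_
  refine mem_gradedPart_of_mem (by_contra fun hT => ?_) ((h.sum_eq_and_mem hV v).2 d)
  exact Finsupp.mem_support_iff.mp hd (hv d hT)

theorem eq_zero_of_forall (h : IsSplitting V Θ) (hV : ⨆ d, V d = ⊤) {v : M} (hv : ∀ d, Θ v d = 0) : v = 0 := by
  have := (h.sum_eq_and_mem hV v).1
  rwa [show Θ v = 0 from Finsupp.ext hv, Finsupp.sum_zero_index, eq_comm] at this

theorem disjoint (h : IsSplitting V Θ) (hV : ⨆ d, V d = ⊤) {T T' : Set ℝ} (hT : Disjoint T T') :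
    Disjoint (gradedPart V T) (gradedPart V T') := by
  rw [Submodule.disjoint_def]
  intro v hv hv'
  refine h.eq_zero_of_forall hV fun d => ?_
  by_cases hd : d ∈ T
  · exact h.apply_eq_zero hv' (Set.disjoint_left.mp hT hd)
  · exact h.apply_eq_zero hv hd

end IsSplitting

end GradedPart

/-! ### The grading of the restricted enveloping algebra -/

section Coaction

variable {k L : Type*} [CommRing k] [LieRing L] [LieAlgebra k L] {p : ℕ} {f : L → L}

namespace Enveloping

theorem ι_lie (a b : L) : ι k p f ⁅a, b⁆ = ι k p f a * ι k p f b - ι k p f b * ι k p f a := by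
  have := RingQuot.mkAlgHom_rel k (EnvelopingRel.lie (k := k) (p := p) (f := f) a b)
  rw [map_sub, map_mul, map_mul] at this
  exact this.symm

theorem ι_pMap (a : L) : ι k p f (f a) = ι k p f a ^ p := by
  have := RingQuot.mkAlgHom_rel k (EnvelopingRel.pow (k := k) (p := p) (f := f) a)
  rw [map_pow] at this
  exact this.symm

theorem exists_lift {A : Type*} [Ring A] [Algebra k A] (φ : L →ₗ[k] A)
    (hlie : ∀ a b, φ ⁅a, b⁆ = φ a * φ b - φ b * φ a) (hpow : ∀ a, φ (f a) = φ a ^ p) :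
    ∃ Φ : Enveloping k p f →ₐ[k] A, ∀ a, Φ (ι k p f a) = φ a := by
  have hrel : ∀ ⦃x y⦄, EnvelopingRel k p f x y →
      TensorAlgebra.lift k φ x = TensorAlgebra.lift k φ y := by
    rintro _ _ (⟨a, b⟩ | a)
    · simp [hlie]
    · simp [hpow]
  refine ⟨RingQuot.liftAlgHom k ⟨TensorAlgebra.lift k φ, hrel⟩, fun a => ?_⟩
  exact (RingQuot.liftAlgHom_mkAlgHom_apply k _ hrel _).trans (TensorAlgebra.lift_ι_apply φ a)

theorem induction_on {C : Enveloping k p f → Prop} (u : Enveloping k p f)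
    (algebraMap : ∀ c, C (algebraMap k _ c)) (ι : ∀ a, C (ι k p f a))
    (mul : ∀ u v, C u → C v → C (u * v)) (add : ∀ u v, C u → C v → C (u + v)) : C u := by
  obtain ⟨t, rfl⟩ := RingQuot.mkAlgHom_surjective k (EnvelopingRel k p f) u
  induction t using TensorAlgebra.induction with
  | algebraMap c => rw [AlgHom.commutes]; exact algebraMap c
  | ι a => exact ι a
  | mul s t hs ht => rw [map_mul]; exact mul _ _ hs ht
  | add s t hs ht => rw [map_add]; exact add _ _ hs ht

variable {ℒ : ℝ → Submodule k L}

theorem one_mem_homogeneous : (1 : Enveloping k p f) ∈ homogeneous k p f ℒ 0 :=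
  Submodule.subset_span ⟨[], by simp, by simp, by simp⟩

theorem ι_mem_homogeneous {d : ℝ} {a : L} (ha : a ∈ ℒ d) :
    ι k p f a ∈ homogeneous k p f ℒ d :=
  Submodule.subset_span ⟨[(d, a)], by simpa using ha, by simp, by simp⟩

theorem mul_mem_homogeneous {d e : ℝ} {u v : Enveloping k p f}
    (hu : u ∈ homogeneous k p f ℒ d) (hv : v ∈ homogeneous k p f ℒ e) :
    u * v ∈ homogeneous k p f ℒ (d + e) := by
  refine Submodule.mul_le.1 ?_ u hu v hv
  rw [homogeneous, homogeneous, Submodule.span_mul_span]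
  refine Submodule.span_mono ?_
  rintro _ ⟨_, ⟨l, hl, hd, rfl⟩, _, ⟨l', hl', he, rfl⟩, rfl⟩
  refine ⟨l ++ l', fun q hq => ?_, by simp [hd, he], by simp⟩
  rcases List.mem_append.mp hq with h | h
  exacts [hl q h, hl' q h]

theorem mul_mem_gradedPart {T T' T'' : Set ℝ} (hT : ∀ d ∈ T, ∀ e ∈ T', d + e ∈ T'')
    {u v : Enveloping k p f} (hu : u ∈ gradedPart (homogeneous k p f ℒ) T)
    (hv : v ∈ gradedPart (homogeneous k p f ℒ) T') :
    u * v ∈ gradedPart (homogeneous k p f ℒ) T'' := by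
  have h1 : ∀ d ∈ T, ∀ w ∈ homogeneous k p f ℒ d,
      gradedPart (homogeneous k p f ℒ) T' ≤
        (gradedPart (homogeneous k p f ℒ) T'').comap (LinearMap.mulLeft k w) := fun d hd w hw =>
    gradedPart_le.2 fun e he x hx =>
      mem_gradedPart_of_mem (hT d hd e he) (mul_mem_homogeneous hw hx)
  have h2 : gradedPart (homogeneous k p f ℒ) T ≤
      (gradedPart (homogeneous k p f ℒ) T'').comap (LinearMap.mulRight k v) :=
    gradedPart_le.2 fun d hd w hw => h1 d hd w hw hv
  exact h2 hu

theorem ι_mem_gradedPart {T : Set ℝ} {a : L} (ha : a ∈ gradedPart ℒ T) :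
    ι k p f a ∈ gradedPart (homogeneous k p f ℒ) T := by
  have : gradedPart ℒ T ≤ (gradedPart (homogeneous k p f ℒ) T).comap (ι k p f) :=
    gradedPart_le.2 fun d hd w hw => mem_gradedPart_of_mem hd (ι_mem_homogeneous hw)
  exact this ha

theorem iSup_homogeneous (hℒ : ⨆ d, ℒ d = ⊤) : ⨆ d, homogeneous k p f ℒ d = ⊤ := by
  rw [eq_top_iff, ← gradedPart_univ]
  intro u _
  have h1 : (1 : Enveloping k p f) ∈ gradedPart (homogeneous k p f ℒ) Set.univ :=
    mem_gradedPart_of_mem (Set.mem_univ _) one_mem_homogeneous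
  induction u using induction_on with
  | algebraMap c => rw [Algebra.algebraMap_eq_smul_one]; exact Submodule.smul_mem _ _ h1
  | ι a =>
    refine ι_mem_gradedPart ?_
    rw [gradedPart_univ, hℒ]
    trivial
  | mul u v hu hv =>
    exact mul_mem_gradedPart (fun _ _ _ _ => Set.mem_univ _) (hu trivial) (hv trivial)
  | add u v hu hv => exact add_mem (hu trivial) (hv trivial)

end Enveloping

theorem IsPMap.map_zero (hf : IsPMap k p f) [Fact p.Prime] : f 0 = 0 := by
  have := hf.smul 0 0
  rwa [zero_smul, zero_pow (Fact.out (p := p.Prime)).ne_zero, zero_smul] at this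

-- By Jacobson's formula on both sides, compatibility of `φ` with `p`-th powers is additive, so it
-- need only be checked on homogeneous elements.
attribute [local instance] LieRing.ofAssociativeRing in
theorem IsPMap.map_add_eq_pow (hf : IsPMap k p f) [Fact p.Prime] {A : Type*} [Ring A]
    (h0 : (p : A) = 0) (φ : L →+ A) (hlie : ∀ a b, φ ⁅a, b⁆ = φ a * φ b - φ b * φ a) {a b : L}
    (ha : φ (f a) = φ a ^ p) (hb : φ (f b) = φ b ^ p) : φ (f (a + b)) = φ (a + b) ^ p := by
  rw [hf.add, map_add, map_add, map_add, ha, hb, add_pow_eq_jacobsonSum h0,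
    map_jacobsonSum φ hlie]

/-- The map `a ↦ a T^d`, for `a` of degree `d`, from `L` to the group algebra of ℝ over `U(L)`
respects the defining relations. Its extension to `U(L)` sends `u` of degree `d` to `u T^d`, which
separates degrees without any basis theorem. -/
theorem exists_isSplitting_homogeneous (hf : IsPMap k p f) [Fact p.Prime] [CharP k p]
    {ℒ : ℝ → Submodule k L} (hℒ : DirectSum.IsInternal ℒ)
    (hlie : ∀ (d e : ℝ) (a b : L), a ∈ ℒ d → b ∈ ℒ e → ⁅a, b⁆ ∈ ℒ (d + e))
    (hpow : ∀ (d : ℝ) (a : L), a ∈ ℒ d → f a ∈ ℒ (p * d)) :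
    ∃ Θ, IsSplitting (Enveloping.homogeneous k p f ℒ) Θ := by
  obtain ⟨θ, hθ⟩ := exists_isSplitting hℒ
  let A := AddMonoidAlgebra (Enveloping k p f) ℝ
  let φ : L →ₗ[k] A := (AddMonoidAlgebra.coeffLinearEquiv k).symm.toLinearMap ∘ₗ
    Finsupp.mapRange.linearMap (Enveloping.ι k p f) ∘ₗ θ
  have hφ : ∀ d, ∀ a ∈ ℒ d, φ a = AddMonoidAlgebra.single d (Enveloping.ι k p f a) := by
    intro d a ha
    simp only [φ, LinearMap.comp_apply, hθ d a ha, Finsupp.mapRange.linearMap_apply,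
      Finsupp.mapRange_single]
    rfl
  have htop : ∀ a, a ∈ ⨆ d, ℒ d := fun a => hℒ.submodule_iSup_eq_top ▸ Submodule.mem_top
  have hφlie : ∀ a b, φ ⁅a, b⁆ = φ a * φ b - φ b * φ a := by
    intro a b
    refine Submodule.iSup_induction ℒ (motive := fun a => φ ⁅a, b⁆ = φ a * φ b - φ b * φ a)
      (htop a) (fun d a ha => ?_) (by simp) fun a c ha hc => ?_
    · refine Submodule.iSup_induction ℒ (motive := fun b => φ ⁅a, b⁆ = φ a * φ b - φ b * φ a)
        (htop b) (fun e b hb => ?_) (by simp) fun b c hb hc => ?_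
      · rw [hφ d a ha, hφ e b hb, hφ _ _ (hlie d e a b ha hb), AddMonoidAlgebra.single_mul_single,
          AddMonoidAlgebra.single_mul_single, Enveloping.ι_lie, add_comm e d,
          AddMonoidAlgebra.single_sub]
      · rw [lie_add, map_add, map_add, hb, hc]
        noncomm_ring
    · rw [add_lie, map_add, map_add, ha, hc]
      noncomm_ring
  have h0 : (p : A) = 0 := by
    rw [← map_natCast (algebraMap k A), CharP.cast_eq_zero, map_zero]
  have hφpow : ∀ a, φ (f a) = φ a ^ p := by
    intro a
    refine Submodule.iSup_induction ℒ (motive := fun a => φ (f a) = φ a ^ p)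
      (htop a) (fun d a ha => ?_) ?_ fun a b ha hb => ?_
    · rw [hφ d a ha, hφ _ _ (hpow d a ha), AddMonoidAlgebra.single_pow, Enveloping.ι_pMap,
        nsmul_eq_mul]
    · rw [hf.map_zero, map_zero, zero_pow (Fact.out (p := p.Prime)).ne_zero]
    · exact hf.map_add_eq_pow h0 φ.toAddMonoidHom hφlie ha hb
  obtain ⟨Φ, hΦ⟩ := Enveloping.exists_lift φ hφlie hφpow
  refine ⟨(AddMonoidAlgebra.coeffLinearEquiv k).toLinearMap ∘ₗ Φ.toLinearMap, fun d u hu => ?_⟩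
  suffices h : Φ u = AddMonoidAlgebra.single d u by
    simp only [LinearMap.comp_apply, AlgHom.toLinearMap_apply, h]
    rfl
  have hspan : ∀ l : List (ℝ × L), (∀ q ∈ l, q.2 ∈ ℒ q.1) →
      Φ (l.map fun q => Enveloping.ι k p f q.2).prod = AddMonoidAlgebra.single
        (l.map Prod.fst).sum (l.map fun q => Enveloping.ι k p f q.2).prod := by
    intro l hl
    induction l with
    | nil => simpa using AddMonoidAlgebra.one_def
    | cons q l ih =>
      rw [List.map_cons, List.prod_cons, map_mul, ih fun q' hq' => hl q' (List.mem_cons_of_mem _ hq'),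
        hΦ, hφ q.1 q.2 (hl q List.mem_cons_self), AddMonoidAlgebra.single_mul_single, List.map_cons,
        List.sum_cons]
  induction hu using Submodule.span_induction with
  | mem u hu =>
    obtain ⟨l, hl, rfl, rfl⟩ := hu
    exact hspan l hl
  | zero => simp
  | add u v _ _ hu hv => rw [map_add, hu, hv, AddMonoidAlgebra.single_add]
  | smul c u _ hu => rw [map_smul, hu, AddMonoidAlgebra.smul_single]

theorem isInternal_signPart {ℒ : ℝ → Submodule k L} {Θ}
    (hΘ : IsSplitting (Enveloping.homogeneous k p f ℒ) Θ) (hℒ : ⨆ d, ℒ d = ⊤) :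
    DirectSum.IsInternal (Enveloping.signPart k p f ℒ) := by
  have hU := Enveloping.iSup_homogeneous (p := p) (f := f) hℒ
  refine DirectSum.isInternal_submodule_of_iSupIndep_of_iSup_eq_top (fun s => ?_) ?_
  · refine (hΘ.disjoint hU (T := {d | SignType.sign d = s}) (T' := {d | SignType.sign d ≠ s})
      (Set.disjoint_left.mpr fun d hd hd' => hd' hd)).mono_right ?_
    refine iSup₂_le fun t ht => gradedPart_mono ?_
    rintro d rfl
    exact ht
  · rw [eq_top_iff, ← hU]
    refine iSup_le fun d => le_trans ?_ (le_iSup _ (SignType.sign d))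
    exact fun u hu => mem_gradedPart_of_mem (T := {e | SignType.sign e = SignType.sign d}) rfl hu

end Coaction

/-! ### Finiteness of the positive grading -/

section Generators

variable {k L : Type*} [CommRing k] [LieRing L] [LieAlgebra k L] {p : ℕ} {f : L → L}

/-- `G` is a set of homogeneous generators, each given with its positive degree, of the components
of the family `ℒ`; it has finitely many elements of bounded degree. -/
structure IsPositiveBasis (ℒ : ℝ → Submodule k L) (G : Set (ℝ × L)) : Prop where
  pos : ∀ q ∈ G, 0 < q.1
  mem : ∀ q ∈ G, q.2 ∈ ℒ q.1
  finite : ∀ N : ℝ, {q ∈ G | q.1 ≤ N}.Finite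
  le_span : ∀ d, ℒ d ≤ Submodule.span k {a | (d, a) ∈ G}

theorem IsPositiveBasis.eq_bot {ℒ : ℝ → Submodule k L} {G : Set (ℝ × L)}
    (hG : IsPositiveBasis ℒ G) {d : ℝ} (hd : d ≤ 0) : ℒ d = ⊥ := by
  rw [eq_bot_iff]
  refine (hG.le_span d).trans (Submodule.span_le.2 fun a ha => ?_)
  exact absurd (hG.pos _ ha) hd.not_gt

/-- The elements obtained from the generators `G` by Lie brackets and `p`-th powers, with
their degrees. -/
inductive RestrictedMonomial (p : ℕ) (f : L → L) (G : Set (ℝ × L)) : ℝ × L → Prop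
  | gen (q : ℝ × L) : q ∈ G → RestrictedMonomial p f G q
  | lie (q r : ℝ × L) : RestrictedMonomial p f G q → RestrictedMonomial p f G r →
      RestrictedMonomial p f G (q.1 + r.1, ⁅q.2, r.2⁆)
  | pow (q : ℝ × L) : RestrictedMonomial p f G q → RestrictedMonomial p f G (p * q.1, f q.2)

namespace RestrictedMonomial

variable {G : Set (ℝ × L)}

theorem le_degree [hp : Fact p.Prime] {δ : ℝ} (hδ : 0 < δ) (hG : ∀ q ∈ G, δ ≤ q.1)
    {q : ℝ × L} (hq : RestrictedMonomial p f G q) : δ ≤ q.1 := by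
  induction hq with
  | gen q hq => exact hG q hq
  | lie q r _ _ hq hr => exact hq.trans (by simp only; linarith)
  | pow q _ hq =>
    have : (1 : ℝ) ≤ p := by exact_mod_cast hp.out.one_le
    exact hq.trans (le_mul_of_one_le_left (hδ.le.trans hq) this)

/-- Every monomial has degree at least `δ`, so forming a bracket or a `p`-th power raises the degree
by at least `δ`. Hence monomials of degree below `(n + 1) * δ` are generators or arise in one
operation from those below `n * δ`. -/
theorem finite [hp : Fact p.Prime] {δ : ℝ} (hδ : 0 < δ) (hG : ∀ q ∈ G, δ ≤ q.1)
    (hfin : G.Finite) (N : ℝ) : {q | RestrictedMonomial p f G q ∧ q.1 ≤ N}.Finite := by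
  have key : ∀ n : ℕ, {q | RestrictedMonomial p f G q ∧ q.1 < n * δ}.Finite := by
    intro n
    induction n with
    | zero =>
      refine Set.finite_empty.subset ?_
      rintro q ⟨hq, hlt⟩
      have := hq.le_degree hδ hG
      simp at hlt
      linarith
    | succ n ih =>
      refine ((hfin.union (ih.image2 (fun q r => (q.1 + r.1, ⁅q.2, r.2⁆)) ih)).union
        (ih.image fun q => ((p : ℝ) * q.1, f q.2))).subset ?_
      rintro q ⟨hq, hlt⟩
      push_cast at hlt
      cases hq with
      | gen _ hq => exact Or.inl (Or.inl hq)
      | lie q r hq hr =>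
        have h1 := hq.le_degree hδ hG
        have h2 := hr.le_degree hδ hG
        simp only at hlt
        exact Or.inl (Or.inr ⟨q, ⟨hq, by linarith⟩, r, ⟨hr, by linarith⟩, rfl⟩)
      | pow q hq =>
        have h1 := hq.le_degree hδ hG
        have h2 : (2 : ℝ) ≤ p := by exact_mod_cast hp.out.two_le
        simp only at hlt
        have h3 : 2 * q.1 ≤ p * q.1 := mul_le_mul_of_nonneg_right h2 (by linarith)
        exact Or.inr ⟨q, ⟨hq, by linarith⟩, rfl⟩
  obtain ⟨n, hn⟩ := exists_nat_gt (N / δ)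
  refine (key n).subset fun q hq => ⟨hq.1, hq.2.trans_lt ?_⟩
  rwa [div_lt_iff₀ hδ] at hn

/-- The span is closed under brackets, and therefore under the `p`-mapping: the correction terms in
Jacobson's formula are Lie polynomials. -/
theorem span_eq_top [Fact p.Prime] (hf : IsPMap k p f)
    (hG : GeneratesRestricted k f (Prod.snd '' G)) :
    Submodule.span k {a | ∃ d, RestrictedMonomial p f G (d, a)} = ⊤ := by
  set V := Submodule.span k {a | ∃ d, RestrictedMonomial p f G (d, a)} with hV
  have hlie : ∀ a b, a ∈ V → b ∈ V → ⁅a, b⁆ ∈ V := by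
    intro a b ha hb
    induction ha using Submodule.span_induction with
    | mem a ha =>
      induction hb using Submodule.span_induction with
      | mem b hb =>
        obtain ⟨d, hd⟩ := ha
        obtain ⟨e, he⟩ := hb
        exact Submodule.subset_span ⟨d + e, lie _ _ hd he⟩
      | zero => rw [lie_zero]; exact zero_mem _
      | add b c _ _ hb hc => rw [lie_add]; exact add_mem hb hc
      | smul c b _ hb => rw [lie_smul]; exact Submodule.smul_mem _ _ hb
    | zero => rw [zero_lie]; exact zero_mem _
    | add a c _ _ ha hc => rw [add_lie]; exact add_mem ha hc
    | smul c a _ ha => rw [smul_lie]; exact Submodule.smul_mem _ _ ha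
  let W : LieSubalgebra k L := { V with lie_mem' := fun {a b} ha hb => hlie a b ha hb }
  have hW : W = ⊤ := by
    refine hG W ?_ fun a ha => ?_
    · rintro _ ⟨q, hq, rfl⟩
      exact Submodule.subset_span ⟨q.1, gen q hq⟩
    · change a ∈ V at ha
      change f a ∈ V
      induction ha using Submodule.span_induction with
      | mem a ha =>
        obtain ⟨d, hd⟩ := ha
        exact Submodule.subset_span ⟨_, pow _ hd⟩
      | zero => rw [hf.map_zero]; exact zero_mem _
      | add a b ha hb hfa hfb =>
        rw [hf.add]
        exact add_mem (add_mem hfa hfb) (jacobsonSum_mem V hlie p ha hb)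
      | smul c a _ ha => rw [hf.smul]; exact Submodule.smul_mem _ _ ha
  have := congrArg LieSubalgebra.toSubmodule hW
  exact this

theorem mem {ℒ : ℝ → Submodule k L}
    (hlie : ∀ (d e : ℝ) (a b : L), a ∈ ℒ d → b ∈ ℒ e → ⁅a, b⁆ ∈ ℒ (d + e))
    (hpow : ∀ (d : ℝ) (a : L), a ∈ ℒ d → f a ∈ ℒ (p * d)) (hG : ∀ q ∈ G, q.2 ∈ ℒ q.1)
    {q : ℝ × L} (hq : RestrictedMonomial p f G q) : q.2 ∈ ℒ q.1 := by
  induction hq with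
  | gen q hq => exact hG q hq
  | lie q r _ _ hq hr => exact hlie _ _ _ _ hq hr
  | pow q _ hq => exact hpow _ _ hq

end RestrictedMonomial

theorem exists_isPositiveBasis [Fact p.Prime] (hf : IsPMap k p f) {ℒ : ℝ → Submodule k L}
    (hℒ : DirectSum.IsInternal ℒ)
    (hlie : ∀ (d e : ℝ) (a b : L), a ∈ ℒ d → b ∈ ℒ e → ⁅a, b⁆ ∈ ℒ (d + e))
    (hpow : ∀ (d : ℝ) (a : L), a ∈ ℒ d → f a ∈ ℒ (p * d)) (S : Finset L)
    (hS : ∀ s ∈ S, ∃ d : ℝ, 0 < d ∧ s ∈ ℒ d) (hgen : GeneratesRestricted k f (S : Set L)) :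
    ∃ G, IsPositiveBasis ℒ G := by
  choose! D hD using hS
  let G : Set (ℝ × L) := (fun s => (D s, s)) '' (S : Set L)
  have hfin : G.Finite := S.finite_toSet.image _
  obtain ⟨δ, hδ, hGδ⟩ : ∃ δ : ℝ, 0 < δ ∧ ∀ q ∈ G, δ ≤ q.1 := by
    rcases S.eq_empty_or_nonempty with rfl | hne
    · exact ⟨1, one_pos, by simp [G]⟩
    · obtain ⟨s, hs, hmin⟩ := S.exists_min_image D hne
      refine ⟨D s, (hD s hs).1, ?_⟩
      rintro _ ⟨t, ht, rfl⟩
      exact hmin t ht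
  have hGmem : ∀ q ∈ G, q.2 ∈ ℒ q.1 := by
    rintro _ ⟨t, ht, rfl⟩
    exact (hD t ht).2
  have himage : Prod.snd '' G = (S : Set L) := by
    simp [G, Set.image_image]
  have htop := RestrictedMonomial.span_eq_top hf (p := p) (himage ▸ hgen)
  obtain ⟨Θ, hΘ⟩ := exists_isSplitting hℒ
  refine ⟨{q | RestrictedMonomial p f G q}, fun q hq => hδ.trans_le (hq.le_degree hδ hGδ),
    fun q hq => hq.mem hlie hpow hGmem, RestrictedMonomial.finite hδ hGδ hfin, fun d a ha => ?_⟩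
  -- Monomials are homogeneous, so projecting a combination to degree `d` keeps only monomials of
  -- degree `d`.
  have key : ∀ b ∈ Submodule.span k {a | ∃ d, RestrictedMonomial p f G (d, a)},
      Θ b d ∈ Submodule.span k {a | RestrictedMonomial p f G (d, a)} := by
    intro b hb
    induction hb using Submodule.span_induction with
    | mem b hb =>
      obtain ⟨e, he⟩ := hb
      rw [hΘ e b (he.mem hlie hpow hGmem), Finsupp.single_apply]
      split_ifs with h
      · exact Submodule.subset_span (h ▸ he)
      · exact zero_mem _
    | zero => simp
    | add b c _ _ hb hc => rw [map_add]; exact add_mem hb hc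
    | smul c b _ hb => rw [map_smul]; exact Submodule.smul_mem _ _ hb
  have := key a (htop ▸ Submodule.mem_top)
  rwa [hΘ d a ha, Finsupp.single_eq_same] at this

end Generators

/-! ### Elements of bounded degree -/

section BoundedDegree

variable {k M : Type*} [CommRing k] [AddCommGroup M] [Module k M] {V : ℝ → Submodule k M}

/-- The sum of the components of a family of submodules with degree at most `r` in absolute
value. -/
def boundedPart (V : ℝ → Submodule k M) (r : ℝ) : Submodule k M :=
  gradedPart V {d | |d| ≤ r}

theorem boundedPart_mono {r r' : ℝ} (h : r ≤ r') : boundedPart V r ≤ boundedPart V r' :=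
  gradedPart_mono fun d hd => by
    rw [Set.mem_ofPred_eq] at hd ⊢
    exact hd.trans h

theorem mem_boundedPart_of_mem {r d : ℝ} (hd : |d| ≤ r) {v : M} (hv : v ∈ V d) :
    v ∈ boundedPart V r :=
  mem_gradedPart_of_mem (Set.mem_ofPred_eq ▸ hd) hv

theorem exists_mem_boundedPart (hV : ⨆ d, V d = ⊤) (v : M) : ∃ r, v ∈ boundedPart V r := by
  refine Submodule.iSup_induction V (motive := fun v => ∃ r, v ∈ boundedPart V r)
    (hV ▸ Submodule.mem_top) (fun d w hw => ⟨|d|, mem_boundedPart_of_mem le_rfl hw⟩)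
    ⟨0, zero_mem _⟩ ?_
  rintro v w ⟨r, hr⟩ ⟨s, hs⟩
  exact ⟨max r s, add_mem (boundedPart_mono (le_max_left _ _) hr)
    (boundedPart_mono (le_max_right _ _) hs)⟩

theorem exists_subset_boundedPart (hV : ⨆ d, V d = ⊤) {s : Set M} (hs : s.Finite) :
    ∃ r, 0 ≤ r ∧ s ⊆ boundedPart V r := by
  induction s, hs using Set.Finite.induction_on with
  | empty => exact ⟨0, le_rfl, Set.empty_subset _⟩
  | @insert v s _ _ ih =>
    obtain ⟨r, hr0, hr⟩ := ih
    obtain ⟨t, ht⟩ := exists_mem_boundedPart hV v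
    refine ⟨max r t, le_max_of_le_left hr0, Set.insert_subset ?_ ?_⟩
    · exact boundedPart_mono (le_max_right _ _) ht
    · exact hr.trans (boundedPart_mono (le_max_left _ _))

theorem exists_forall_eq_bot [Module.Finite k M] (hV : DirectSum.IsInternal V) :
    ∃ D, 0 ≤ D ∧ ∀ d, D < |d| → V d = ⊥ := by
  have htop := hV.submodule_iSup_eq_top
  obtain ⟨s, hs⟩ := Module.Finite.fg_top (R := k) (M := M)
  obtain ⟨D, hD0, hD⟩ := exists_subset_boundedPart htop s.finite_toSet
  obtain ⟨Θ, hΘ⟩ := exists_isSplitting hV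
  refine ⟨D, hD0, fun d hd => ?_⟩
  have h1 : boundedPart V D = ⊤ := by
    rw [eq_top_iff, ← hs]
    exact Submodule.span_le.2 hD
  have h2 := hΘ.disjoint htop (T := {e | |e| ≤ D}) (T' := {d})
    (Set.disjoint_singleton_right.mpr fun h => not_le.mpr hd h)
  rw [eq_bot_iff]
  intro v hv
  exact Submodule.disjoint_def.mp h2 v (h1 ▸ Submodule.mem_top :) 
    (mem_gradedPart_of_mem (Set.mem_singleton d) hv)

end BoundedDegree

/-! ### Comparison of the two gradings of `L` through the wreath product -/

section Wreath

variable {k X L : Type*} [CommRing k] [CommRing X] [Algebra k X] [LieRing L] [LieAlgebra k L]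

/-- Faithfulness enters the argument only as injectivity of `ψ`. -/
theorem IsFaithful.eq_zero {ψ : L →ₗ⁅k⁆ Wreath k X L} (h : IsFaithful ψ) {a : L}
    (ha : ψ a = 0) : a = 0 := by
  refine h a fun w => ?_
  cases w with
  | nil => rfl
  | cons x w =>
    simp only [naturalAction, LinearMap.add_apply, LinearMap.comp_apply, LieHom.coe_toLinearMap,
      LinearMap.coe_mk, AddHom.coe_mk, ha, map_zero, zero_add]
    simp

/-- The elements of degree `d` of `X ⊗ L`, where `y ⊗ a` has degree `deg y + dil * deg a`. -/
def tensorDegree (dil : ℝ) (𝒳 : ℝ → Submodule k X) (ℒ : ℝ → Submodule k L) (d : ℝ) :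
    Submodule k (X ⊗[k] L) :=
  Submodule.span k {t : X ⊗[k] L | ∃ (e f : ℝ) (y : X) (a : L),
      y ∈ 𝒳 e ∧ a ∈ ℒ f ∧ e + dil * f = d ∧ t = y ⊗ₜ[k] a}

variable {𝒳 : ℝ → Submodule k X} {ℒ : ℝ → Submodule k L} {dil : ℝ}

theorem tmul_mem_gradedPart {T T' T'' : Set ℝ} (hT : ∀ d ∈ T, ∀ e ∈ T', d + dil * e ∈ T'')
    {y : X} {a : L} (hy : y ∈ gradedPart 𝒳 T) (ha : a ∈ gradedPart ℒ T') :
    y ⊗ₜ[k] a ∈ gradedPart (tensorDegree dil 𝒳 ℒ) T'' := by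
  have h1 : ∀ d ∈ T, ∀ w ∈ 𝒳 d, gradedPart ℒ T' ≤
      (gradedPart (tensorDegree dil 𝒳 ℒ) T'').comap (TensorProduct.mk k X L w) :=
    fun d hd w hw => gradedPart_le.2 fun e he x hx =>
      mem_gradedPart_of_mem (hT d hd e he) (Submodule.subset_span ⟨d, e, w, x, hw, hx, rfl, rfl⟩)
  have h2 : gradedPart 𝒳 T ≤
      (gradedPart (tensorDegree dil 𝒳 ℒ) T'').comap ((TensorProduct.mk k X L).flip a) :=
    gradedPart_le.2 fun d hd w hw => h1 d hd w hw ha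
  exact h2 hy

/-- The bigrading of `X ⊗ L` is pushed forward along `(e, f) ↦ e + dil * f`. -/
theorem exists_isSplitting_tensorDegree (h𝒳 : DirectSum.IsInternal 𝒳)
    (hℒ : DirectSum.IsInternal ℒ) : ∃ Θ, IsSplitting (tensorDegree dil 𝒳 ℒ) Θ := by
  obtain ⟨ξ, hξ⟩ := exists_isSplitting h𝒳
  obtain ⟨θ, hθ⟩ := exists_isSplitting hℒ
  refine ⟨Finsupp.lmapDomain (X ⊗[k] L) k (fun q : ℝ × ℝ => q.1 + dil * q.2) ∘ₗ
    (finsuppTensorFinsupp k k X L ℝ ℝ).toLinearMap ∘ₗ TensorProduct.map ξ θ, fun d v hv => ?_⟩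
  induction hv using Submodule.span_induction with
  | mem v hv =>
    obtain ⟨e, f, y, a, hy, ha, rfl, rfl⟩ := hv
    simp only [LinearMap.comp_apply, TensorProduct.map_tmul, hξ e y hy, hθ f a ha,
      LinearEquiv.coe_coe, finsuppTensorFinsupp_single, Finsupp.lmapDomain_apply,
      Finsupp.mapDomain_single]
  | zero => simp
  | add v w _ _ hv hw => rw [map_add, hv, hw, Finsupp.single_add]
  | smul c v _ hv => rw [map_smul, hv, Finsupp.smul_single]

variable {p : ℕ} {f : L → L} {ψ : L →ₗ⁅k⁆ Wreath k X L}

/-- All degrees of `X` lie in `[-D, D]`, so a derivation shifting degrees by more than `2 * D` is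
zero. -/
theorem IsSelfSimilarGrading.right_eq_zero (hgr : IsSelfSimilarGrading p f ψ dil 𝒳 ℒ) {D : ℝ}
    (hD : ∀ d, D < |d| → 𝒳 d = ⊥) {d : ℝ} (hd : 2 * D < |d|) {a : L} (ha : a ∈ ℒ d) :
    (ψ a).right = 0 := by
  have htop := hgr.alphabet_isInternal.submodule_iSup_eq_top
  ext x
  refine Submodule.iSup_induction 𝒳 (motive := fun x => (ψ a).right x = 0)
    (htop ▸ Submodule.mem_top : x ∈ ⨆ d, 𝒳 d) (fun e y hy => ?_) (map_zero _) fun y z hy hz => ?_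
  · have h1 := (hgr.compatible d a ha).2 e y hy
    by_cases he : D < |e|
    · rw [hD e he, Submodule.mem_bot] at hy
      rw [hy, map_zero]
    · have h2 : |d| ≤ |d + e| + |e| := by
        simpa using abs_sub (d + e) e
      rw [hD (d + e) (by linarith [not_lt.mp he]), Submodule.mem_bot] at h1
      exact h1
  · rw [map_add, hy, hz, add_zero]

/-- The degrees of an element of `L` are controlled by those of the first coordinate of its image
in the wreath product. -/
theorem IsSelfSimilarGrading.mem_boundedPart (hgr : IsSelfSimilarGrading p f ψ dil 𝒳 ℒ)
    (hψ : IsFaithful ψ) {D : ℝ} (hD : ∀ d, D < |d| → 𝒳 d = ⊥) {r : ℝ} (hr : 2 * D ≤ r) {a : L}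
    (ha : (ψ a).left ∈ boundedPart (tensorDegree dil 𝒳 ℒ) r) : a ∈ boundedPart ℒ r := by
  have htop := hgr.isInternal.submodule_iSup_eq_top
  obtain ⟨θ, hθ⟩ := exists_isSplitting hgr.isInternal
  obtain ⟨Θ, hΘ⟩ := exists_isSplitting_tensorDegree (dil := dil) hgr.alphabet_isInternal
    hgr.isInternal
  -- Since `ψ` preserves degrees, it commutes with taking components; a component of `a` of degree
  -- beyond `r` then has both coordinates of its image zero.
  have hcomp : ∀ (b : L) (d : ℝ), Θ (ψ b).left d = (ψ (θ b d)).left := by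
    intro b d
    refine Submodule.iSup_induction ℒ (motive := fun b => Θ (ψ b).left d = (ψ (θ b d)).left)
      (htop ▸ Submodule.mem_top : b ∈ ⨆ d, ℒ d) (fun e c hc => ?_) ?_ fun b c hb hc => ?_
    · rw [hΘ e _ (hgr.compatible e c hc).1, hθ e c hc, Finsupp.single_apply, Finsupp.single_apply]
      split_ifs
      · rfl
      · rw [map_zero]; rfl
    · simp
    · rw [map_add, map_add, Finsupp.add_apply, map_add]
      change Θ ((ψ b).left + (ψ c).left) d = (ψ (θ b d)).left + (ψ (θ c d)).left
      rw [map_add, Finsupp.add_apply, hb, hc]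
  refine hθ.mem_gradedPart htop fun d hd => hψ.eq_zero ?_
  rw [Set.mem_ofPred_eq, not_le] at hd
  have h1 : (ψ (θ a d)).left = 0 := by
    rw [← hcomp]
    exact hΘ.apply_eq_zero ha fun h => not_le.mpr hd h
  have h2 : (ψ (θ a d)).right = 0 :=
    hgr.right_eq_zero hD (hr.trans_lt hd) ((hθ.sum_eq_and_mem htop a).2 d)
  exact LieAlgebra.SemiDirectSum.ext h1 h2

variable {𝒳lam 𝒳mu : ℝ → Submodule k X} {ℒlam ℒmu : ℝ → Submodule k L} {lam mu : ℝ}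

/-- Induction on `n`: if `y ⊗ b` occurs in the image of `a`, then the λ-degree of `b` is at most `(d
+ D) / lam`, which leads from level `n + 1` to level `n`. The μ-bound is multiplied by `|mu|`, up to
an additive constant. -/
theorem exists_le_boundedPart_pow [Module.Finite k X] (hψ : IsFaithful ψ) (hmu : 1 < |mu|)
    (hlam : 1 < lam) (hgrlam : IsSelfSimilarGrading p f ψ lam 𝒳lam ℒlam)
    (hgrmu : IsSelfSimilarGrading p f ψ mu 𝒳mu ℒmu) {G : Set (ℝ × L)}
    (hG : IsPositiveBasis ℒlam G) :
    ∃ s R : ℝ, 0 ≤ s ∧ 0 ≤ R ∧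
      ∀ n : ℕ, ∀ d ≤ s + lam ^ n, ℒlam d ≤ boundedPart ℒmu (R * |mu| ^ n) := by
  obtain ⟨D, hD0, hD⟩ := exists_forall_eq_bot hgrlam.alphabet_isInternal
  obtain ⟨E, hE0, hE⟩ := exists_forall_eq_bot hgrmu.alphabet_isInternal
  have htop := hgrmu.isInternal.submodule_iSup_eq_top
  have hXtop : boundedPart 𝒳mu E = ⊤ := by
    rw [eq_top_iff, ← hgrmu.alphabet_isInternal.submodule_iSup_eq_top]
    refine iSup_le fun d y hy => ?_
    by_cases hd : E < |d|
    · rw [hE d hd, Submodule.mem_bot] at hy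
      exact hy ▸ zero_mem _
    · exact mem_boundedPart_of_mem (not_lt.mp hd) hy
  -- The fixed point of `s ↦ (s + D) / lam`, so that the error `D` is absorbed at each level.
  set s := D / (lam - 1) with hs
  have hlam' : 0 < lam - 1 := by linarith
  have hs' : s + D = lam * s := by
    rw [hs]
    field_simp
    ring
  -- The μ-bounds obey `R ↦ 2 * E + |mu| * R`, whose fixed point is `-K`. The constant `2 * E`,
  -- rather than `E`, also meets the threshold beyond which the derivation coordinate vanishes.
  set K := 2 * E / (|mu| - 1) with hK
  have hmu' : 0 < |mu| - 1 := by linarith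
  have hK' : |mu| * K = K + 2 * E := by
    rw [hK]
    field_simp
    ring
  have hs0 : 0 ≤ s := by positivity
  have hK0 : 0 ≤ K := by positivity
  obtain ⟨R₀, hR₀, hbase⟩ := exists_subset_boundedPart htop ((hG.finite (s + 1)).image Prod.snd)
  have key : ∀ n : ℕ, ∀ d ≤ s + lam ^ n,
      ℒlam d ≤ boundedPart ℒmu ((R₀ + K) * |mu| ^ n - K) := by
    intro n
    induction n with
    | zero =>
      intro d hd
      refine (hG.le_span d).trans (Submodule.span_le.2 fun a ha => ?_)
      rw [pow_zero, mul_one, add_sub_cancel_right]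
      exact hbase ⟨(d, a), ⟨ha, by simpa using hd⟩, rfl⟩
    | succ n ih =>
      intro d hd a ha
      have hpow : 1 ≤ |mu| ^ n := one_le_pow₀ hmu.le
      set R := (R₀ + K) * |mu| ^ n - K with hR
      have hR0 : 0 ≤ R := by
        have : (R₀ + K) * 1 ≤ (R₀ + K) * |mu| ^ n := by gcongr
        linarith
      have hR1 : (R₀ + K) * |mu| ^ (n + 1) - K = 2 * E + |mu| * R := by
        rw [hR, pow_succ]
        linear_combination hK'
      rw [hR1]
      have hmuR : 0 ≤ |mu| * R := by positivity
      refine hgrmu.mem_boundedPart hψ hE (by linarith) ?_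
      have hle : tensorDegree lam 𝒳lam ℒlam d ≤
          boundedPart (tensorDegree mu 𝒳mu ℒmu) (2 * E + |mu| * R) := by
        refine Submodule.span_le.2 ?_
        rintro _ ⟨e, g, y, b, hy, hb, rfl, rfl⟩
        by_cases he : D < |e|
        · rw [hD e he, Submodule.mem_bot] at hy
          rw [hy, TensorProduct.zero_tmul]
          exact zero_mem _
        · have hg : g ≤ s + lam ^ n := by
            have h1 : lam * g ≤ lam * (s + lam ^ n) := by
              rw [pow_succ] at hd
              have := neg_le_of_abs_le (not_lt.mp he)
              linarith
            exact le_of_mul_le_mul_left h1 (by linarith)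
          refine tmul_mem_gradedPart (T := {x | |x| ≤ E}) (T' := {x | |x| ≤ R}) ?_
            (hXtop ▸ Submodule.mem_top : y ∈ boundedPart 𝒳mu E) (ih g hg hb)
          intro x hx z hz
          rw [Set.mem_ofPred_eq] at hx hz ⊢
          calc |x + mu * z| ≤ |x| + |mu| * |z| := by rw [← abs_mul]; exact abs_add_le _ _
            _ ≤ E + |mu| * R := add_le_add hx (mul_le_mul_of_nonneg_left hz (abs_nonneg _))
            _ ≤ 2 * E + |mu| * R := by linarith
      exact hle (hgrlam.compatible d a ha).1
  refine ⟨s, R₀ + K, hs0, by positivity, fun n d hd => ?_⟩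
  exact (key n d hd).trans (boundedPart_mono (by linarith))

theorem exists_forall_le_boundedPart [Module.Finite k X] (hψ : IsFaithful ψ) (hmu : 1 < |mu|)
    (hlam : |mu| < lam) (hgrlam : IsSelfSimilarGrading p f ψ lam 𝒳lam ℒlam)
    (hgrmu : IsSelfSimilarGrading p f ψ mu 𝒳mu ℒmu) {G : Set (ℝ × L)}
    (hG : IsPositiveBasis ℒlam G) {ε : ℝ} (hε : 0 < ε) :
    ∃ D : ℝ, ∀ d, D < d → ℒlam d ≤ boundedPart ℒmu (ε * d) := by
  have hlam1 := hmu.trans hlam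
  obtain ⟨s, R, hs, hR, h⟩ := exists_le_boundedPart_pow hψ hmu hlam1 hgrlam hgrmu hG
  have hlim : Filter.Tendsto (fun n : ℕ => R * |mu| * (|mu| / lam) ^ n) Filter.atTop (nhds 0) := by
    have := (tendsto_pow_atTop_nhds_zero_of_lt_one (r := |mu| / lam) (by positivity)
      ((div_lt_one (by linarith)).mpr hlam)).const_mul (R * |mu|)
    rwa [mul_zero] at this
  obtain ⟨n₀, hn₀⟩ := Filter.eventually_atTop.mp (hlim.eventually_le_const hε)
  have hpow : ∀ n ≥ n₀, R * |mu| ^ (n + 1) ≤ ε * lam ^ n := by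
    intro n hn
    have h1 := hn₀ n hn
    have h2 : 0 < lam ^ n := pow_pos (by linarith) n
    rw [div_pow, ← mul_div_assoc, div_le_iff₀ h2] at h1
    calc R * |mu| ^ (n + 1) = R * |mu| * |mu| ^ n := by ring
      _ ≤ ε * lam ^ n := h1
  refine ⟨s + lam ^ n₀, fun d hd => ?_⟩
  have hex : ∃ m : ℕ, d ≤ s + lam ^ m := by
    obtain ⟨m, hm⟩ := pow_unbounded_of_one_lt d hlam1
    exact ⟨m, by linarith⟩
  classical
  -- For the least exponent `m = j + 1`, minimality gives `lam ^ j < d`, turning the bound `R * |mu|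
  -- ^ (j + 1) ≤ ε * lam ^ j` into one by `ε * d`.
  have hm := Nat.find_spec hex
  have hmin : ∀ j < Nat.find hex, ¬ d ≤ s + lam ^ j := fun j hj => Nat.find_min hex hj
  generalize Nat.find hex = m at hm hmin
  have hlt : n₀ < m := by
    by_contra hle
    have := pow_le_pow_right₀ hlam1.le (not_lt.mp hle)
    linarith
  obtain ⟨j, rfl⟩ : ∃ j, m = j + 1 := ⟨m - 1, by omega⟩
  refine (h _ d hm).trans (boundedPart_mono ((hpow j (by omega)).trans ?_))
  have := not_le.mp (hmin j (Nat.lt_succ_self j))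
  gcongr
  linarith

end Wreath

/-! ### Straightening words in the enveloping algebra -/

section Straightening

variable {k L : Type*} [CommRing k] [LieRing L] [LieAlgebra k L] {p : ℕ} {f : L → L}

open Enveloping

/-- The elements of `L` whose left multiplication raises the index of the family `M` by `d`. -/
def raising (M : ℝ → Submodule k (Enveloping k p f)) (d : ℝ) : Submodule k L where
  carrier := {a | ∀ m, ∀ u ∈ M m, ι k p f a * u ∈ M (m + d)}
  zero_mem' := fun m u _ => by simp
  add_mem' := fun ha hb m u hu => by
    rw [map_add, add_mul]
    exact add_mem (ha m u hu) (hb m u hu)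
  smul_mem' := fun c a ha m u hu => by
    rw [map_smul, smul_mul_assoc]
    exact Submodule.smul_mem _ _ (ha m u hu)

/-- The family spanned by the products of the powers of `b` with exponent less than `n` and the
elements of the family `M`, where `b` has degree `d`. -/
def powExtension (M : ℝ → Submodule k (Enveloping k p f)) (b : L) (d : ℝ) (n : ℕ) (m : ℝ) :
    Submodule k (Enveloping k p f) :=
  ⨆ (j : ℕ) (_ : j < n), (M (m - j * d)).map (LinearMap.mulLeft k (ι k p f b ^ j))

variable {M : ℝ → Submodule k (Enveloping k p f)} {b : L} {d : ℝ}

theorem pow_mul_mem_powExtension {n j : ℕ} (hj : j < n) {m : ℝ} {u : Enveloping k p f}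
    (hu : u ∈ M m) {m' : ℝ} (hm : m + j * d = m') :
    ι k p f b ^ j * u ∈ powExtension M b d n m' := by
  refine Submodule.mem_iSup_of_mem j (Submodule.mem_iSup_of_mem hj ⟨u, ?_, rfl⟩)
  rwa [← hm, add_sub_cancel_right]

theorem powExtension_le {n : ℕ} {m : ℝ} {W : Submodule k (Enveloping k p f)} :
    powExtension M b d n m ≤ W ↔
      ∀ j < n, ∀ u ∈ M (m - j * d), ι k p f b ^ j * u ∈ W := by
  rw [powExtension, iSup₂_le_iff]
  exact forall₂_congr fun j _ => Submodule.map_le_iff_le_comap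

theorem powExtension_mono {n n' : ℕ} (h : n ≤ n') (m : ℝ) :
    powExtension M b d n m ≤ powExtension M b d n' m :=
  powExtension_le.2 fun _ hj _ hu =>
    pow_mul_mem_powExtension (hj.trans_le h) hu (sub_add_cancel _ _)

theorem le_powExtension {n : ℕ} (hn : 0 < n) (m : ℝ) : M m ≤ powExtension M b d n m := by
  intro u hu
  simpa using pow_mul_mem_powExtension (b := b) (d := d) (j := 0) hn hu (by simp)

theorem ι_mul_mem_powExtension {n : ℕ} {m : ℝ} {u : Enveloping k p f}
    (hu : u ∈ powExtension M b d n m) : ι k p f b * u ∈ powExtension M b d (n + 1) (m + d) := by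
  have : powExtension M b d n m ≤
      (powExtension M b d (n + 1) (m + d)).comap (LinearMap.mulLeft k (ι k p f b)) := by
    refine powExtension_le.2 fun j hj v hv => ?_
    rw [Submodule.mem_comap, LinearMap.mulLeft_apply, ← mul_assoc, ← pow_succ']
    refine pow_mul_mem_powExtension (Nat.succ_lt_succ hj) hv ?_
    push_cast
    ring
  exact this hu

variable {ℒ : ℝ → Submodule k L}

/-- Moving `z` past one factor `b` creates the commutator `⁅z, b⁆`. Degrees in `L` are positive, so
it has degree greater than `d` and raises `M` by hypothesis; the induction applies to it as well. -/
theorem ι_mul_pow_mul_mem_powExtension (hpos : ∀ d ≤ 0, ℒ d = ⊥)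
    (hlie : ∀ (d e : ℝ) (a b : L), a ∈ ℒ d → b ∈ ℒ e → ⁅a, b⁆ ∈ ℒ (d + e))
    (hb : b ∈ ℒ d) (hM : ∀ e, d < e → ℒ e ≤ raising M e) (j : ℕ) {e : ℝ} {z : L}
    (hz : z ∈ ℒ e) (hzM : z ∈ raising M e) {m : ℝ} {u : Enveloping k p f} (hu : u ∈ M m) :
    ι k p f z * (ι k p f b ^ j * u) ∈ powExtension M b d (j + 1) (m + j * d + e) := by
  induction j generalizing e z with
  | zero => simpa using le_powExtension Nat.one_pos _ (hzM m u hu)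
  | succ j ih =>
    have h1 : ι k p f z * (ι k p f b ^ (j + 1) * u) =
        ι k p f b * (ι k p f z * (ι k p f b ^ j * u)) + ι k p f ⁅z, b⁆ * (ι k p f b ^ j * u) := by
      rw [ι_lie, pow_succ']
      noncomm_ring
    have h2 : m + (j + 1 : ℕ) * d + e = m + j * d + e + d := by push_cast; ring
    rw [h1, h2]
    refine add_mem (ι_mul_mem_powExtension (ih hz hzM)) ?_
    rcases le_or_gt e 0 with he | he
    · rw [hpos e he, Submodule.mem_bot] at hz
      simp [hz]
    · have h3 := hlie _ _ _ _ hz hb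
      rw [add_assoc _ e d]
      exact powExtension_mono (Nat.le_succ _) _ (ih h3 (hM _ (by linarith) h3))

theorem raising_le_raising_powExtension (hpos : ∀ d ≤ 0, ℒ d = ⊥)
    (hlie : ∀ (d e : ℝ) (a b : L), a ∈ ℒ d → b ∈ ℒ e → ⁅a, b⁆ ∈ ℒ (d + e))
    (hb : b ∈ ℒ d) (hM : ∀ e, d < e → ℒ e ≤ raising M e) {n : ℕ} {e : ℝ} {z : L}
    (hz : z ∈ ℒ e) (hzM : z ∈ raising M e) : z ∈ raising (powExtension M b d n) e := by
  intro m u hu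
  have : powExtension M b d n m ≤
      (powExtension M b d n (m + e)).comap (LinearMap.mulLeft k (ι k p f z)) := by
    refine powExtension_le.2 fun j hj v hv => ?_
    have := ι_mul_pow_mul_mem_powExtension hpos hlie hb hM j hz hzM hv
    rw [sub_add_cancel] at this
    exact powExtension_mono hj _ this
  exact this hu

/-- When the exponent reaches `p`, the power `b ^ p` is replaced by `f b`, of degree `p * d > d`,
which raises `M` itself. -/
theorem mem_raising_powExtension [hp : Fact p.Prime] (hd : 0 < d)
    (hpow : ∀ (d : ℝ) (a : L), a ∈ ℒ d → f a ∈ ℒ (p * d))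
    (hb : b ∈ ℒ d) (hM : ∀ e, d < e → ℒ e ≤ raising M e) :
    b ∈ raising (powExtension M b d p) d := by
  intro m u hu
  have : powExtension M b d p m ≤
      (powExtension M b d p (m + d)).comap (LinearMap.mulLeft k (ι k p f b)) := by
    refine powExtension_le.2 fun j hj v hv => ?_
    rw [Submodule.mem_comap, LinearMap.mulLeft_apply, ← mul_assoc, ← pow_succ']
    rcases Nat.lt_or_ge (j + 1) p with h | h
    · refine pow_mul_mem_powExtension h hv ?_
      push_cast
      ring
    · obtain rfl : p = j + 1 := le_antisymm h hj
      rw [← ι_pMap]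
      refine le_powExtension hp.out.pos _ ?_
      have h1 : d < (j + 1 : ℕ) * d := by
        have : (1 : ℝ) < (j + 1 : ℕ) := by exact_mod_cast hp.out.one_lt
        exact lt_mul_of_one_lt_left hd this
      have h2 := hM _ h1 (hpow d b hb) _ v hv
      convert h2 using 2
      push_cast
      ring
  exact this hu

variable {ℒmu : ℝ → Submodule k L}

theorem mul_mem_boundedPart {r s : ℝ} {u v : Enveloping k p f}
    (hu : u ∈ boundedPart (homogeneous k p f ℒmu) r)
    (hv : v ∈ boundedPart (homogeneous k p f ℒmu) s) :
    u * v ∈ boundedPart (homogeneous k p f ℒmu) (r + s) := by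
  refine mul_mem_gradedPart (fun x hx y hy => ?_) hu hv
  rw [Set.mem_ofPred_eq] at hx hy ⊢
  exact (abs_add_le x y).trans (add_le_add hx hy)

theorem one_mem_boundedPart : (1 : Enveloping k p f) ∈ boundedPart (homogeneous k p f ℒmu) 0 :=
  mem_boundedPart_of_mem (by simp) one_mem_homogeneous

theorem pow_mem_boundedPart {r : ℝ} {u : Enveloping k p f}
    (hu : u ∈ boundedPart (homogeneous k p f ℒmu) r) (n : ℕ) :
    u ^ n ∈ boundedPart (homogeneous k p f ℒmu) (n * r) := by
  induction n with
  | zero => simpa using one_mem_boundedPart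
  | succ n ih =>
    rw [pow_succ, Nat.cast_succ, add_mul, one_mul]
    exact mul_mem_boundedPart ih hu

theorem powExtension_le_boundedPart {n : ℕ} {C ε R : ℝ} (hε : 0 ≤ ε) (hd : 0 ≤ d) (hR : 0 ≤ R)
    (hM : ∀ m, M m ≤ boundedPart (homogeneous k p f ℒmu) (C + ε * m))
    (hb : ι k p f b ∈ boundedPart (homogeneous k p f ℒmu) R) (m : ℝ) :
    powExtension M b d n m ≤ boundedPart (homogeneous k p f ℒmu) (C + n * R + ε * m) := by
  refine powExtension_le.2 fun j hj u hu => ?_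
  refine boundedPart_mono ?_ (mul_mem_boundedPart (pow_mem_boundedPart hb j) (hM _ hu))
  have h1 : (j : ℝ) * R ≤ n * R :=
    mul_le_mul_of_nonneg_right (by exact_mod_cast hj.le) hR
  have h2 : 0 ≤ ε * (j * d) := by positivity
  linarith

/-- Only the finitely many generators of degree at most `D` can break the ε-bound. They are adjoined
in decreasing order of degree by `powExtension`, so that when `q` is adjoined everything of larger
degree already raises the family; each adjunction increases only the constant `C`. -/
theorem exists_raising_family [Fact p.Prime] {G : Set (ℝ × L)} (hG : IsPositiveBasis ℒ G)
    (hlie : ∀ (d e : ℝ) (a b : L), a ∈ ℒ d → b ∈ ℒ e → ⁅a, b⁆ ∈ ℒ (d + e))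
    (hpow : ∀ (d : ℝ) (a : L), a ∈ ℒ d → f a ∈ ℒ (p * d)) (hmu : ⨆ d, ℒmu d = ⊤)
    {ε D : ℝ} (hε : 0 < ε) (hD : ∀ d, D < d → ℒ d ≤ boundedPart ℒmu (ε * d)) :
    ∃ (M : ℝ → Submodule k (Enveloping k p f)) (C : ℝ), 1 ∈ M 0 ∧
      (∀ m, M m ≤ boundedPart (homogeneous k p f ℒmu) (C + ε * m)) ∧
      ∀ d, ℒ d ≤ raising M d := by
  classical
  have hpos : ∀ d ≤ 0, ℒ d = ⊥ := fun d hd => hG.eq_bot hd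
  set F := (hG.finite D).toFinset with hF
  have hFmem : ∀ q, q ∈ F ↔ q ∈ G ∧ q.1 ≤ D := fun q => by simp [hF]
  -- The condition on `s` says that it consists of top-degree elements of `F`; ties are harmless.
  have key : ∀ s : Finset (ℝ × L), s ⊆ F → (∀ q ∈ F, q ∉ s → ∀ r ∈ s, q.1 ≤ r.1) →
      ∃ (M : ℝ → Submodule k (Enveloping k p f)) (C : ℝ), 1 ∈ M 0 ∧
        (∀ m, M m ≤ boundedPart (homogeneous k p f ℒmu) (C + ε * m)) ∧
        (∀ d, D < d → ℒ d ≤ raising M d) ∧ ∀ q ∈ s, q.2 ∈ raising M q.1 := by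
    intro s
    induction s using Finset.induction_on_min_value (fun q : ℝ × L => q.1) with
    | empty =>
      intro _ _
      refine ⟨fun m => boundedPart (homogeneous k p f ℒmu) (ε * m), 0, ?_, fun m => ?_, ?_, ?_⟩
      · simpa using one_mem_boundedPart
      · rw [zero_add]
      · intro d hd a ha m u hu
        beta_reduce at hu ⊢
        rw [mul_add, add_comm]
        exact mul_mem_boundedPart (ι_mem_gradedPart (hD d hd ha)) hu
      · simp
    | insert q s hq hmin ih =>
      intro hsub hup
      obtain ⟨M, C, h1, hC, hMD, hMs⟩ := ih ((Finset.subset_insert _ _).trans hsub) (by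
        intro r hr hrs t ht
        by_cases hrq : r = q
        · exact hrq ▸ hmin t ht
        · exact hup r hr (by simp [hrq, hrs]) t (Finset.mem_insert_of_mem ht))
      have hqG := (hFmem q).1 (hsub (Finset.mem_insert_self q s))
      have hqmem := hG.mem q hqG.1
      have hqpos := hG.pos q hqG.1
      have hM : ∀ e, q.1 < e → ℒ e ≤ raising M e := by
        intro e he
        rcases lt_or_ge D e with h | h
        · exact hMD e h
        · refine (hG.le_span e).trans (Submodule.span_le.2 fun a ha => ?_)
          refine hMs (e, a) (by_contra fun hs => ?_)
          have hne : (e, a) ∉ insert q s := by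
            rw [Finset.mem_insert, not_or]
            refine ⟨fun h => ?_, hs⟩
            rw [← h] at he
            exact lt_irrefl _ he
          exact absurd (hup (e, a) ((hFmem _).2 ⟨ha, h⟩) hne q (Finset.mem_insert_self q s))
            (not_le.mpr he)
      obtain ⟨R, hR0, hR⟩ := exists_subset_boundedPart hmu (Set.finite_singleton q.2)
      refine ⟨powExtension M q.2 q.1 p, C + p * R,
        le_powExtension (Fact.out (p := p.Prime)).pos _ h1,
        powExtension_le_boundedPart hε.le hqpos.le hR0 hC (ι_mem_gradedPart (hR rfl)),
        fun d hd a ha => ?_, fun r hr => ?_⟩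
      · exact raising_le_raising_powExtension hpos hlie hqmem hM ha (hMD d hd ha)
      · rcases Finset.mem_insert.mp hr with rfl | hr
        · exact mem_raising_powExtension hqpos hpow hqmem hM
        · have hrG := (hFmem r).1 (hsub (Finset.mem_insert_of_mem hr))
          exact raising_le_raising_powExtension hpos hlie hqmem hM (hG.mem r hrG.1) (hMs r hr)
  obtain ⟨M, C, h1, hC, hMD, hMF⟩ := key F subset_rfl fun q hq hq' => absurd hq hq'
  refine ⟨M, C, h1, hC, fun d => ?_⟩
  rcases lt_or_ge D d with h | h
  · exact hMD d h
  · exact (hG.le_span d).trans (Submodule.span_le.2 fun a ha => hMF (d, a) ((hFmem _).2 ⟨ha, h⟩))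

theorem exists_homogeneous_le_boundedPart [Fact p.Prime] {G : Set (ℝ × L)}
    (hG : IsPositiveBasis ℒ G)
    (hlie : ∀ (d e : ℝ) (a b : L), a ∈ ℒ d → b ∈ ℒ e → ⁅a, b⁆ ∈ ℒ (d + e))
    (hpow : ∀ (d : ℝ) (a : L), a ∈ ℒ d → f a ∈ ℒ (p * d)) (hmu : ⨆ d, ℒmu d = ⊤)
    {ε D : ℝ} (hε : 0 < ε) (hD : ∀ d, D < d → ℒ d ≤ boundedPart ℒmu (ε * d)) :
    ∃ C : ℝ, ∀ m, homogeneous k p f ℒ m ≤ boundedPart (homogeneous k p f ℒmu) (C + ε * m) := by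
  obtain ⟨M, C, h1, hC, hM⟩ := exists_raising_family hG hlie hpow hmu hε hD
  refine ⟨C, fun m => (Submodule.span_le.2 ?_).trans (hC m)⟩
  rintro _ ⟨l, hl, rfl, rfl⟩
  -- A word is obtained from `1 ∈ M 0` by successive left multiplications, each raising the index by
  -- the degree of its letter.
  induction l with
  | nil => simpa using h1
  | cons q l ih =>
    simp only [List.map_cons, List.prod_cons, List.sum_cons]
    rw [add_comm]
    exact hM _ (hl q List.mem_cons_self) _ _ (ih fun r hr => hl r (List.mem_cons_of_mem _ hr))

end Straightening

/-! ### Vanishing of long products -/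

section LocallyNilpotent

/-- The spans `W j` of words of length at least `j` in `F` are multiplicative in `j`, and the
non-unital subalgebra generated by `F` lies in `W 1`. -/
theorem isLocallyNilpotent_of_lists {k A : Type*} [CommRing k] [Ring A] [Algebra k A]
    {V : Set A} (h : ∀ F : Finset A, (F : Set A) ⊆ V → ∃ n : ℕ, ∀ l : List A, n ≤ l.length →
      (∀ x ∈ l, x ∈ F) → l.prod = 0) : IsLocallyNilpotent k V := by
  intro F hF
  obtain ⟨n, hn⟩ := h F hF
  let W : ℕ → Submodule k A := fun j =>
    Submodule.span k {u | ∃ l : List A, j ≤ l.length ∧ (∀ x ∈ l, x ∈ F) ∧ u = l.prod}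
  have hmul : ∀ i j, ∀ u ∈ W i, ∀ v ∈ W j, u * v ∈ W (i + j) := by
    intro i j u hu v hv
    refine Submodule.mul_le.1 ?_ u hu v hv
    rw [Submodule.span_mul_span]
    refine Submodule.span_mono ?_
    rintro _ ⟨_, ⟨l, hl, hlF, rfl⟩, _, ⟨l', hl', hlF', rfl⟩, rfl⟩
    refine ⟨l ++ l', by rw [List.length_append]; omega, fun x hx => ?_, by simp⟩
    rcases List.mem_append.mp hx with h | h
    exacts [hlF x h, hlF' x h]
  have hmono : W (1 + 1) ≤ W 1 := Submodule.span_mono fun u hu => by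
    obtain ⟨l, hl, hlF, rfl⟩ := hu
    exact ⟨l, by omega, hlF, rfl⟩
  have hadj : ∀ x ∈ NonUnitalAlgebra.adjoin k (F : Set A), x ∈ W 1 := by
    intro x hx
    induction hx using NonUnitalAlgebra.adjoin_induction with
    | mem x hx => exact Submodule.subset_span ⟨[x], by simp, by simpa using hx, by simp⟩
    | add x y _ _ hx hy => exact add_mem hx hy
    | zero => exact zero_mem _
    | mul x y _ _ hx hy => exact hmono (hmul 1 1 x hx y hy)
    | smul c x _ hx => exact Submodule.smul_mem _ c hx
  have hprod : ∀ l : List A, (∀ x ∈ l, x ∈ NonUnitalAlgebra.adjoin k (F : Set A)) →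
      l.prod ∈ W l.length := by
    intro l hl
    induction l with
    | nil => exact Submodule.subset_span ⟨[], by simp, by simp, rfl⟩
    | cons x l ih =>
      rw [List.prod_cons, List.length_cons, add_comm]
      exact hmul 1 _ x (hadj x (hl x List.mem_cons_self)) _
        (ih fun y hy => hl y (List.mem_cons_of_mem _ hy))
  refine ⟨n, fun l hl hlF => ?_⟩
  have h1 : W n ≤ ⊥ := Submodule.span_le.2 fun u hu => by
    obtain ⟨l, hl, hlF, rfl⟩ := hu
    exact hn l hl hlF
  exact h1 (hl ▸ hprod l hlF)

variable {k L : Type*} [CommRing k] [LieRing L] [LieAlgebra k L] {p : ℕ} {f : L → L}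
  {ℒlam ℒmu : ℝ → Submodule k L}

open Enveloping

theorem exists_forall_mem_gradedPart {M : Type*} [AddCommGroup M] [Module k M]
    {V : ℝ → Submodule k M} {σ : ℝ} (F : Finset M)
    (hF : (F : Set M) ⊆ gradedPart V {d | 0 < σ * d}) :
    ∃ η : ℝ, 0 < η ∧ ∀ u ∈ F, u ∈ gradedPart V {d | η ≤ σ * d} := by
  have hmono : ∀ η η' : ℝ, η ≤ η' →
      gradedPart V {d | η' ≤ σ * d} ≤ gradedPart V {d | η ≤ σ * d} :=
    fun η η' h => gradedPart_mono fun d hd => by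
      rw [Set.mem_ofPred_eq] at hd ⊢
      exact h.trans hd
  have key : ∀ u ∈ gradedPart V {d | 0 < σ * d},
      ∃ η : ℝ, 0 < η ∧ u ∈ gradedPart V {d | η ≤ σ * d} := by
    intro u hu
    rw [gradedPart, iSup_subtype'] at hu
    refine Submodule.iSup_induction _
      (motive := fun u => ∃ η : ℝ, 0 < η ∧ u ∈ gradedPart V {d | η ≤ σ * d}) hu ?_
      ⟨1, one_pos, zero_mem _⟩ ?_
    · rintro ⟨d, hd⟩ v hv
      exact ⟨σ * d, hd, mem_gradedPart_of_mem (d := d) (Set.mem_ofPred_eq ▸ le_rfl) hv⟩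
    · rintro v w ⟨η, h0, hv⟩ ⟨η', h0', hw⟩
      exact ⟨min η η', lt_min h0 h0', add_mem (hmono _ _ (min_le_left _ _) hv)
        (hmono _ _ (min_le_right _ _) hw)⟩
  choose! η h0 hη using key
  rcases F.eq_empty_or_nonempty with rfl | hne
  · exact ⟨1, one_pos, by simp⟩
  · obtain ⟨v, hv, hmin⟩ := F.exists_min_image η hne
    exact ⟨η v, h0 v (hF hv), fun u hu => hmono _ _ (hmin u hu) (hη u (hF hu))⟩

/-- If the degrees for the grading `ℒmu` grow slower than those for the grading `ℒlam`, then long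
products of finitely many elements of degree of constant sign vanish. -/
theorem exists_forall_prod_eq_zero (hlam : ⨆ d, ℒlam d = ⊤) (hmu : ⨆ d, ℒmu d = ⊤) {Θ}
    (hΘ : IsSplitting (homogeneous k p f ℒmu) Θ)
    (hbound : ∀ ε : ℝ, 0 < ε → ∃ C : ℝ, ∀ m,
      homogeneous k p f ℒlam m ≤ boundedPart (homogeneous k p f ℒmu) (C + ε * m))
    {σ : ℝ} (hσ : |σ| = 1) (F : Finset (Enveloping k p f))
    (hF : (F : Set (Enveloping k p f)) ⊆ gradedPart (homogeneous k p f ℒmu) {d | 0 < σ * d}) :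
    ∃ n : ℕ, ∀ l : List (Enveloping k p f), n ≤ l.length → (∀ x ∈ l, x ∈ F) → l.prod = 0 := by
  -- The sign `σ` treats U₊ and U₋ together: `σ * d` is bounded below by `η` on the degrees in `F`.
  obtain ⟨η, hη0, hη⟩ := exists_forall_mem_gradedPart F hF
  obtain ⟨m, hm0, hm⟩ := exists_subset_boundedPart
    (iSup_homogeneous (p := p) (f := f) hlam) F.finite_toSet
  have hprodmu : ∀ l : List (Enveloping k p f), (∀ x ∈ l, x ∈ F) →
      l.prod ∈ gradedPart (homogeneous k p f ℒmu) {d | l.length * η ≤ σ * d} := by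
    intro l hl
    induction l with
    | nil => exact mem_gradedPart_of_mem (d := 0) (by simp) one_mem_homogeneous
    | cons x l ih =>
      rw [List.prod_cons]
      refine mul_mem_gradedPart (fun d hd e he => ?_) (hη x (hl x List.mem_cons_self))
        (ih fun y hy => hl y (List.mem_cons_of_mem _ hy))
      rw [Set.mem_ofPred_eq] at hd he ⊢
      rw [List.length_cons]
      push_cast
      linarith
  have hprodlam : ∀ l : List (Enveloping k p f), (∀ x ∈ l, x ∈ F) →
      l.prod ∈ boundedPart (homogeneous k p f ℒlam) (l.length * m) := by
    intro l hl
    induction l with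
    | nil => simpa using one_mem_boundedPart
    | cons x l ih =>
      rw [List.prod_cons, List.length_cons]
      have := mul_mem_boundedPart (hm (hl x List.mem_cons_self))
        (ih fun y hy => hl y (List.mem_cons_of_mem _ hy))
      convert this using 2
      push_cast
      ring
  set ε := η / (2 * (m + 1)) with hε
  have hε0 : 0 < ε := by positivity
  have hεm : ε * m ≤ η / 2 := by
    rw [hε, div_mul_eq_mul_div, div_le_div_iff₀ (by positivity) two_pos]
    nlinarith
  obtain ⟨C, hC⟩ := hbound ε hε0
  -- For length ℓ ≥ `n`, one half of ℓη exceeds `C` and the other half is at least εmℓ, so C + εmℓ <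
  -- ℓη.
  obtain ⟨n, hn⟩ := exists_nat_gt (C / (η / 2))
  rw [div_lt_iff₀ (by positivity)] at hn
  refine ⟨n, fun l hl hlF => ?_⟩
  have hle : boundedPart (homogeneous k p f ℒlam) (l.length * m) ≤
      boundedPart (homogeneous k p f ℒmu) (C + ε * (l.length * m)) := by
    refine gradedPart_le.2 fun d hd => (hC d).trans (boundedPart_mono ?_)
    rw [Set.mem_ofPred_eq] at hd
    have := (le_abs_self d).trans hd
    gcongr
  have hdisj := hΘ.disjoint (iSup_homogeneous (p := p) (f := f) hmu)
    (T := {d | |d| ≤ C + ε * (l.length * m)}) (T' := {d | l.length * η ≤ σ * d}) (by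
      refine Set.disjoint_left.mpr fun d hd hd' => ?_
      rw [Set.mem_ofPred_eq] at hd hd'
      have h1 : σ * d ≤ |d| := by
        have := le_abs_self (σ * d)
        rwa [abs_mul, hσ, one_mul] at this
      have h2 : (n : ℝ) * (η / 2) ≤ l.length * (η / 2) := by
        have : (n : ℝ) ≤ l.length := by exact_mod_cast hl
        gcongr
      have h3 : (l.length : ℝ) * (ε * m) ≤ l.length * (η / 2) := by gcongr
      nlinarith)
  exact Submodule.disjoint_def.mp hdisj _ (hle (hprodlam l hlF)) (hprodmu l hlF)

theorem signPart_eq_gradedPart (ℒ : ℝ → Submodule k L) (s : SignType) :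
    signPart k p f ℒ s = gradedPart (homogeneous k p f ℒ) {d | SignType.sign d = s} :=
  rfl

theorem mul_mem_signPart {ℒ : ℝ → Submodule k L} {s : SignType} {u v : Enveloping k p f}
    (hu : u ∈ signPart k p f ℒ s) (hv : v ∈ signPart k p f ℒ s) :
    u * v ∈ signPart k p f ℒ s := by
  rw [signPart_eq_gradedPart] at hu hv ⊢
  refine mul_mem_gradedPart (fun d hd e he => ?_) hu hv
  rw [Set.mem_ofPred_eq] at hd he ⊢
  cases s with
  | zero =>
    rw [SignType.zero_eq_zero, sign_eq_zero_iff] at hd he ⊢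
    rw [hd, he, add_zero]
  | neg =>
    rw [SignType.neg_eq_neg_one, sign_eq_neg_one_iff] at hd he ⊢
    exact add_neg hd he
  | pos =>
    rw [SignType.pos_eq_one, sign_eq_one_iff] at hd he ⊢
    exact add_pos hd he

end LocallyNilpotent

end SelfSimilarLie

end

/-! ### The main theorem -/

open SelfSimilarLie in
theorem mainTheorem11 {k X L : Type*} [CommRing k] [IsDomain k] {p : ℕ} [Fact p.Prime] [CharP k p]
    [CommRing X] [Algebra k X] [Module.Free k X] [Module.Finite k X]
    [LieRing L] [LieAlgebra k L]
    (f : L → L) (hf : IsPMap k p f)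
    (ψ : L →ₗ⁅k⁆ Wreath k X L) (hψ : PreservesPMap p f ψ) (hfaithful : IsFaithful ψ)
    (lam mu : ℝ) (hmu : 1 < |mu|) (hlam : |mu| < lam)
    (𝒳lam 𝒳mu : ℝ → Submodule k X) (ℒlam ℒmu : ℝ → Submodule k L)
    (hgrlam : IsSelfSimilarGrading p f ψ lam 𝒳lam ℒlam)
    (hgrmu : IsSelfSimilarGrading p f ψ mu 𝒳mu ℒmu)
    (hgen : ∃ S : Finset L, (∀ s ∈ S, ∃ d : ℝ, 0 < d ∧ s ∈ ℒlam d) ∧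
      GeneratesRestricted k f (S : Set L)) :
    DirectSum.IsInternal (Enveloping.signPart k p f ℒmu) ∧
    (1 : Enveloping k p f) ∈ Enveloping.signPart k p f ℒmu 0 ∧
    (∀ (s : SignType) (u v : Enveloping k p f), u ∈ Enveloping.signPart k p f ℒmu s →
      v ∈ Enveloping.signPart k p f ℒmu s → u * v ∈ Enveloping.signPart k p f ℒmu s) ∧
    IsLocallyNilpotent k (Enveloping.signPart k p f ℒmu 1 : Set (Enveloping k p f)) ∧
    IsLocallyNilpotent k (Enveloping.signPart k p f ℒmu (-1) : Set (Enveloping k p f)) ∧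
    (∀ (d : ℝ) (u : Enveloping k p f), d ≠ 0 → u ∈ Enveloping.homogeneous k p f ℒmu d →
      IsNilpotent u) := by
  have hlamtop := hgrlam.isInternal.submodule_iSup_eq_top
  have hmutop := hgrmu.isInternal.submodule_iSup_eq_top
  obtain ⟨Θ, hΘ⟩ := exists_isSplitting_homogeneous hf hgrmu.isInternal hgrmu.lie_mem
    hgrmu.pMap_mem
  obtain ⟨S, hS, hSgen⟩ := hgen
  obtain ⟨G, hG⟩ := exists_isPositiveBasis hf hgrlam.isInternal hgrlam.lie_mem hgrlam.pMap_mem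
    S hS hSgen
  have hbound : ∀ ε : ℝ, 0 < ε → ∃ C : ℝ, ∀ m, Enveloping.homogeneous k p f ℒlam m ≤
      boundedPart (Enveloping.homogeneous k p f ℒmu) (C + ε * m) := by
    intro ε hε
    obtain ⟨D, hD⟩ := exists_forall_le_boundedPart hfaithful hmu hlam hgrlam hgrmu hG hε
    exact exists_homogeneous_le_boundedPart hG hgrlam.lie_mem hgrlam.pMap_mem hmutop hε hD
  have hzero : ∀ σ : ℝ, |σ| = 1 → ∀ F : Finset (Enveloping k p f),
      (F : Set (Enveloping k p f)) ⊆
        gradedPart (Enveloping.homogeneous k p f ℒmu) {d | 0 < σ * d} →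
      ∃ n : ℕ, ∀ l : List (Enveloping k p f), n ≤ l.length → (∀ x ∈ l, x ∈ F) → l.prod = 0 :=
    fun σ hσ F hF => exists_forall_prod_eq_zero hlamtop hmutop hΘ hbound hσ F hF
  refine ⟨isInternal_signPart hΘ hmutop, mem_gradedPart_of_mem (d := 0) sign_zero
    Enveloping.one_mem_homogeneous, fun s u v hu hv => mul_mem_signPart hu hv, ?_, ?_, ?_⟩
  · rw [signPart_eq_gradedPart]
    refine isLocallyNilpotent_of_lists fun F hF => hzero 1 (by simp) F (hF.trans ?_)
    refine gradedPart_mono fun d hd => ?_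
    rw [Set.mem_ofPred_eq, sign_eq_one_iff] at hd
    simpa using hd
  · rw [signPart_eq_gradedPart]
    refine isLocallyNilpotent_of_lists fun F hF => hzero (-1) (by simp) F (hF.trans ?_)
    refine gradedPart_mono fun d hd => ?_
    rw [Set.mem_ofPred_eq, sign_eq_neg_one_iff] at hd
    simpa using hd
  · intro d u hd hu
    obtain ⟨σ, hσ, hσd⟩ : ∃ σ : ℝ, |σ| = 1 ∧ 0 < σ * d := by
      rcases lt_or_gt_of_ne hd with h | h
      · exact ⟨-1, by simp, by linarith⟩
      · exact ⟨1, by simp, by linarith⟩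
    obtain ⟨n, hn⟩ := hzero σ hσ {u} (by
      simpa using mem_gradedPart_of_mem (T := {d | 0 < σ * d}) hσd hu)
    refine ⟨n, ?_⟩
    have := hn (List.replicate n u) (by simp) fun x hx => by
      simpa using List.eq_of_mem_replicate hx
    rwa [List.prod_replicate] at this
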